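/- **Conventions.** All matroids have a finite ground set contained in $\{1,2,3,\dots\}$; let $\mathfrak M$ be the set of all of them and $\mathfrak M_E$ the set of those with ground set $E$. A matroid is *uniform* if its bases are all the $k$-element subsets of its ground set, for some $k$; $\mathsf U_{k,n}$ is the uniform matroid of rank $k$ on $\{1,\dots,n\}$, and in $\mathsf U_{a,b}\oplus\mathsf U_{c,d}$ the summands have ground sets $\{1,\dots,b\}$ and $\{b+1,\dots,b+d\}$. A matroid is *connected* if it is not a direct sum of two non-empty matroids. Let $\mathsf M$ be a matroid with ground set $E$, set of bases $\mathscr B$ and rank $k$. The *cusp* of $A\subseteq E$ is $\operatorname{cusp}(A)=\{S\subseteq E: |S|=k,\ |S\cap A|\ge \operatorname{rk}(A)+1\}$. The set $A$ is *stressed* if both the restriction $\mathsf M|_A$ and the contraction $\mathsf M/A$ are uniform; in that case $\mathscr B\sqcup\operatorname{cusp}(A)$ is the set of bases of a matroid $\operatorname{Rel}(\mathsf M,A)$ on $E$. For $0\le r\le h$ and $0\le k-r\le n-h$, the *cuspidal matroid* is $\mathsf\Lambda_{r,k,h,n}=\operatorname{Rel}(\mathsf U_{k-r,n-h}\oplus\mathsf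 U_{r,h},F)$, where $F$ is the ground set of the summand $\mathsf U_{r,h}$. A *flacet* of $\mathsf M$ is a flat $F$ such that $\mathsf M|_F$ and $\mathsf M/F$ are connected; it is a *split flacet* if moreover $0<\operatorname{rk}(F)<|F|$ and $E\smallsetminus F$ contains an element that is not a coloop. A *connected split matroid* is a connected matroid all of whose split flacets are stressed. An *elementary split matroid* is a matroid that is a connected split matroid or a direct sum of two uniform matroids. The *base polytope* $\mathscr P(\mathsf M)\subseteq\mathbb R^E$ is the convex hull of the vectors $\sum_{i\in B}e_i$, $B\in\mathscr B$. A *subdivision* of a polytope $\mathscr P$ is a finite collection $\mathcal S$ of non-empty polytopes with union $\mathscr P$ that contains every non-empty face of each of its members and in which any two different members intersect in a (possibly empty) common face. Let $A$ be an abelian group. A map $f:\mathfrak M\to A$ is an *invariant* if $f(\mathsf M)=f(\mathsf N)$ whenever $\mathsf M\cong\mathsf N$. It is a *valuation* if, for all $E$, all $\mathsf M\in\mathfrak M_E$ and every subdivision $\mathcal S$ of $\mathscr P(\mathsf M)$ whose members are base polytopes $\mathscr P(\mathsf M_1),\dots,\mathscr P(\mathsf M_s)$ of different matroids $\mathsf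 M_i\in\mathfrak M_E$, $$f(\mathsf M)=\sum_{i\,:\,\mathscr P(\mathsf M_i)\not\subseteq\partial\mathscr P(\mathsf M)}(-1)^{\dim\mathscr P(\mathsf M)-\dim\mathscr P(\mathsf M_i)}f(\mathsf M_i),$$ where $\partial$ denotes the relative boundary. A *valuative invariant* is an invariant that is a valuation. **Theorem.** Let $\mathsf M\in\mathfrak M$ be an elementary split matroid of rank $k$ and cardinality $n$, let $A$ be an abelian group, and let $f:\mathfrak M\to A$ be a valuative invariant. Then $$f(\mathsf M)=f(\mathsf U_{k,n})-\sum_{r,h}\lambda_{r,h}\bigl(f(\mathsf\Lambda_{r,k,h,n})-f(\mathsf U_{k-r,n-h}\oplus\mathsf U_{r,h})\bigr),$$ where $\lambda_{r,h}$ is the number of stressed subsets of $\mathsf M$ with non-empty cusp that have rank $r$ and size $h$. (Whenever $\lambda_{r,h}\ne0$, one has $0\le r\le h$ and $0\le k-r\le n-h$, so that the term is defined; the other terms are zero.) -/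

import Mathlib

noncomputable section

namespace SplitMatroid

universe u v

/-! ### Matroid terminology -/

/-- Isomorphism of matroids: a bijection of the ground sets that preserves bases in both
directions. -/
def Iso {α : Type u} {β : Type v} (M : Matroid α) (N : Matroid β) : Prop :=
  ∃ φ : M.E ≃ N.E, ∀ B : Set M.E,
    M.IsBase (Subtype.val '' B) ↔ N.IsBase (Subtype.val '' (φ '' B))

/-- A matroid is uniform if, for some `k`, its bases are exactly the `k`-element subsets of its
ground set. -/
def IsUniform {α : Type u} (M : Matroid α) : Prop :=
  ∃ k : ℕ, ∀ B : Set α, M.IsBase B ↔ B ⊆ M.E ∧ B.encard = k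

/-- A matroid is connected if it is not a direct sum of two non-empty matroids. -/
def IsConnected {α : Type u} (M : Matroid α) : Prop :=
  ¬ ∃ (M₁ M₂ : Matroid α) (h : Disjoint M₁.E M₂.E),
    M₁.E.Nonempty ∧ M₂.E.Nonempty ∧ M = M₁.disjointSum M₂ h

/-- The cusp of `A` in `M`: the subsets of the ground set whose size is the rank of `M` and which
have at least `rk(A) + 1` elements in `A`. -/
def cusp {α : Type u} (M : Matroid α) (A : Set α) : Set (Set α) :=
  {S | S ⊆ M.E ∧ S.encard = M.eRank ∧ M.eRk A + 1 ≤ (S ∩ A).encard}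

/-- A subset `A` of the ground set is stressed if both the restriction to `A` and the contraction
by `A` are uniform. -/
def IsStressed {α : Type u} (M : Matroid α) (A : Set α) : Prop :=
  A ⊆ M.E ∧ IsUniform (M.restrict A) ∧ IsUniform (M.contract A)

/-- A flacet: a flat for which both the restriction and the contraction are connected. -/
def IsFlacet {α : Type u} (M : Matroid α) (F : Set α) : Prop :=
  M.IsFlat F ∧ IsConnected (M.restrict F) ∧ IsConnected (M.contract F)

/-- A split flacet: a flacet `F` with `0 < rk(F) < |F|` whose complement contains an element that
is not a coloop. -/
def IsSplitFlacet {α : Type u} (M : Matroid α) (F : Set α) : Prop :=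
  IsFlacet M F ∧ 0 < M.eRk F ∧ M.eRk F < F.encard ∧ ∃ e ∈ M.E \ F, ¬ M.IsColoop e

/-- A connected split matroid: a connected matroid all of whose split flacets are stressed. -/
def IsConnectedSplit {α : Type u} (M : Matroid α) : Prop :=
  IsConnected M ∧ ∀ F, IsSplitFlacet M F → IsStressed M F

/-- An elementary split matroid: a connected split matroid or a direct sum of two uniform
matroids. -/
def IsElementarySplit {α : Type u} (M : Matroid α) : Prop :=
  IsConnectedSplit M ∨
    ∃ (M₁ M₂ : Matroid α) (h : Disjoint M₁.E M₂.E),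
      IsUniform M₁ ∧ IsUniform M₂ ∧ M = M₁.disjointSum M₂ h

/-- `stressedCount M r h` is the number of stressed subsets of `M` with non-empty cusp that have
rank `r` and size `h`. -/
def stressedCount {α : Type u} (M : Matroid α) (r h : ℕ) : ℕ :=
  {A : Set α | IsStressed M A ∧ (cusp M A).Nonempty ∧ M.eRk A = r ∧ A.encard = h}.ncard

/-! ### Relaxation of a stressed subset -/

lemma isBase_of_isStressed {α : Type u} {M : Matroid α} [M.Finite] {A S : Set α}
    (hA : IsStressed M A) (hSE : S ⊆ M.E) (hS : S.encard = M.eRank)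
    (hSA : (S ∩ A).encard = M.eRk A) : M.IsBase S := by
  obtain ⟨hAE, ⟨a, ha⟩, ⟨b, hb⟩⟩ := hA
  obtain ⟨I, hI⟩ := M.exists_isBasis A hAE
  have hIa : I.encard = a := ((ha I).1 (Matroid.isBase_restrict_iff hAE |>.2 hI)).2
  have hIr : I.encard = M.eRk A := hI.encard_eq_eRk
  have h1 : M.IsBasis (S ∩ A) A := by
    rw [← Matroid.isBase_restrict_iff hAE, ha]
    exact ⟨Set.inter_subset_right, by rw [hSA, ← hIr, hIa]⟩
  obtain ⟨J, hJ⟩ := (M.contract A).exists_isBase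
  have hJ' := (hI.contract_indep_iff).1 hJ.indep
  obtain ⟨B, hB, hJB⟩ := hJ'.1.exists_isBase_superset
  have hBJ : (M.contract A).Indep (B \ I) := by
    rw [hI.contract_indep_iff]
    refine ⟨hB.indep.subset (Set.union_subset Set.sdiff_subset
      (Set.subset_union_right.trans hJB)), ?_⟩
    rw [Set.disjoint_left]
    rintro x hxA ⟨hxB, hxI⟩
    exact hxI (hI.mem_of_insert_indep hxA
      (hB.indep.subset (Set.insert_subset hxB (Set.subset_union_right.trans hJB))))
  have hJsub : J ⊆ B \ I := fun x hx => ⟨hJB (Or.inl hx), fun hxI =>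
    Set.disjoint_left.1 hJ'.2 (hI.subset hxI) hx⟩
  have hJeq : J = B \ I := hJ.eq_of_subset_indep hBJ hJsub
  have hJb : (B \ I).encard = b := hJeq ▸ ((hb J).1 hJ).2
  have hIB : I ⊆ B := Set.subset_union_right.trans hJB
  have hBk : (B \ I).encard + I.encard = M.eRank := by
    rw [Set.encard_sdiff_add_encard_of_subset hIB, hB.encard_eq_eRank]
  have hSk : (S \ A).encard + (S ∩ A).encard = M.eRank := by
    rw [Set.encard_sdiff_add_encard_inter, hS]
  have hSb : (S \ A).encard = b := by
    have : (S \ A).encard + I.encard = (B \ I).encard + I.encard := by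
      rw [hBk, ← hSk, hSA, hIr]
    rw [hIa] at this
    rw [← hJb]
    simpa using this
  have h2 : (M.contract A).IsBase (S \ A) := by
    rw [hb]
    exact ⟨Set.sdiff_subset_sdiff_left hSE, hSb⟩
  have h3 := (h1.contract_indep_iff.1 h2.indep).1
  rw [Set.sdiff_union_inter] at h3
  exact Matroid.Indep.isBase_of_eRk_ge h3 (M.set_finite S hSE) (by rw [h3.eRk_eq_encard, hS])

lemma relaxation_exchange {α : Type u} {M : Matroid α} [M.Finite] {A : Set α}
    (hA : IsStressed M A) :
    Matroid.ExchangeProperty (fun B => M.IsBase B ∨ B ∈ cusp M A) := by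
  have hfin : ∀ S : Set α, S ⊆ M.E → S.Finite := fun S hS => M.set_finite S hS
  obtain ⟨k, hk⟩ : ∃ k : ℕ, M.eRank = k := by
    obtain ⟨B, hB⟩ := M.exists_isBase
    exact ⟨B.ncard, by rw [← hB.encard_eq_eRank, (hfin B hB.subset_ground).cast_ncard_eq]⟩
  obtain ⟨r, hr⟩ : ∃ r : ℕ, M.eRk A = r := by
    obtain ⟨I, hI⟩ := M.exists_isBasis A hA.1
    exact ⟨I.ncard, by
      rw [← hI.encard_eq_eRk, (hfin I (hI.subset.trans hA.1)).cast_ncard_eq]⟩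
  have hcusp : ∀ S, S ∈ cusp M A ↔ S ⊆ M.E ∧ S.ncard = k ∧ r + 1 ≤ (S ∩ A).ncard := by
    intro S
    simp only [cusp, Set.mem_ofPred_eq]
    refine and_congr_right fun hS => ?_
    rw [hk, hr, ← (hfin S hS).cast_ncard_eq,
      ← (hfin (S ∩ A) (Set.inter_subset_left.trans hS)).cast_ncard_eq]
    norm_cast
  have hbase : ∀ S, S ⊆ M.E → S.ncard = k → (S ∩ A).ncard = r → M.IsBase S := by
    intro S hS h1 h2
    refine isBase_of_isStressed hA hS ?_ ?_
    · rw [hk, ← h1, (hfin S hS).cast_ncard_eq]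
    · rw [hr, ← h2, (hfin _ (Set.inter_subset_left.trans hS)).cast_ncard_eq]
  have hbig : ∀ S, S ⊆ M.E → S.ncard = k → r ≤ (S ∩ A).ncard → M.IsBase S ∨ S ∈ cusp M A := by
    intro S hS h1 h2
    rcases h2.eq_or_lt with h | h
    · exact Or.inl (hbase S hS h1 h.symm)
    · exact Or.inr ((hcusp S).2 ⟨hS, h1, h⟩)
  have hBk : ∀ B, M.IsBase B → B.ncard = k := by
    intro B hB
    have := hB.encard_eq_eRank
    rw [hk, ← (hfin B hB.subset_ground).cast_ncard_eq] at this
    exact_mod_cast this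
  have hall : ∀ B, (M.IsBase B ∨ B ∈ cusp M A) → B ⊆ M.E ∧ B.ncard = k := by
    rintro B (hB | hB)
    · exact ⟨hB.subset_ground, hBk B hB⟩
    · exact ⟨((hcusp B).1 hB).1, ((hcusp B).1 hB).2.1⟩
  have hexch : ∀ (B : Set α) (x y : α), B ⊆ M.E → B.ncard = k → x ∈ B → y ∉ B → y ∈ M.E →
      insert y (B \ {x}) ⊆ M.E ∧ (insert y (B \ {x})).ncard = k ∧
        (B ∩ A).ncard ≤ (insert y (B \ {x}) ∩ A).ncard + 1 ∧
        (y ∈ A → (B ∩ A).ncard ≤ (insert y (B \ {x}) ∩ A).ncard) := by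
    intro B x y hB hBk hx hy hyE
    have hsub : insert y (B \ {x}) ⊆ M.E :=
      Set.insert_subset hyE (Set.sdiff_subset.trans hB)
    have hfi : (insert y (B \ {x}) ∩ A).Finite :=
      hfin _ (Set.inter_subset_left.trans hsub)
    have hfd : ((B ∩ A) \ {x}).Finite :=
      hfin _ ((Set.sdiff_subset.trans Set.inter_subset_left).trans hB)
    have h0 : (B ∩ A).ncard ≤ ((B ∩ A) \ {x}).ncard + 1 :=
      Set.ncard_le_ncard_sdiff_add_ncard (B ∩ A) {x} |>.trans (by simp)
    refine ⟨hsub, ?_, ?_, ?_⟩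
    · rw [Set.ncard_exchange hy hx, hBk]
    · refine h0.trans (Nat.add_le_add_right (Set.ncard_le_ncard ?_ hfi) 1)
      rintro z ⟨⟨hzB, hzA⟩, hzx⟩
      exact ⟨Or.inr ⟨hzB, hzx⟩, hzA⟩
    · intro hyA
      refine h0.trans ?_
      rw [← Set.ncard_insert_of_notMem (a := y) (fun h => hy h.1.1) hfd]
      refine Set.ncard_le_ncard ?_ hfi
      rintro z (rfl | ⟨⟨hzB, hzA⟩, hzx⟩)
      · exact ⟨Or.inl rfl, hyA⟩
      · exact ⟨Or.inr ⟨hzB, hzx⟩, hzA⟩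
  intro B₁ B₂ h₁ h₂ x hx
  obtain ⟨hB₁E, hB₁k⟩ := hall B₁ h₁
  obtain ⟨hB₂E, hB₂k⟩ := hall B₂ h₂
  rcases h₁ with h₁ | h₁
  · rcases h₂ with h₂ | h₂
    · obtain ⟨y, hy, h⟩ := h₁.exchange h₂ hx
      exact ⟨y, hy, Or.inl h⟩
    · have h₂' := ((hcusp B₂).1 h₂).2.2
      rcases lt_or_ge (B₁ ∩ A).ncard r with hlt | hge
      · have hd : r + (k - r) = k := by
          have := Set.ncard_le_ncard (Set.inter_subset_left (s := B₂) (t := A)) (hfin B₂ hB₂E)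
          omega
        have hd1 : (B₁ ∩ A).ncard + (B₁ \ A).ncard = k := by
          rw [Set.ncard_inter_add_ncard_sdiff_eq_ncard _ _ (hfin B₁ hB₁E), hB₁k]
        have hd2 : (B₁ \ A).ncard ≤ ((B₁ \ A) \ {x}).ncard + 1 :=
          Set.ncard_le_ncard_sdiff_add_ncard (B₁ \ A) {x} |>.trans (by simp)
        obtain ⟨Y₁, hY₁, hY₁r⟩ := Set.exists_subset_card_eq (s := B₂ ∩ A) (n := r) (by omega)
        obtain ⟨Y₂, hY₂, hY₂r⟩ :=
          Set.exists_subset_card_eq (s := (B₁ \ A) \ {x}) (n := k - r) (by omega)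
        have hY₁E : Y₁ ⊆ M.E := hY₁.trans (Set.inter_subset_left.trans hB₂E)
        have hY₂E : Y₂ ⊆ M.E :=
          hY₂.trans ((Set.sdiff_subset.trans Set.sdiff_subset).trans hB₁E)
        have hdis : Disjoint Y₁ Y₂ :=
          Set.disjoint_left.2 fun z hz hz' => (hY₂ hz').1.2 (hY₁ hz).2
        have hbase' : M.IsBase (Y₁ ∪ Y₂) := by
          refine hbase _ (Set.union_subset hY₁E hY₂E) ?_ ?_
          · rw [Set.ncard_union_eq hdis (hfin _ hY₁E) (hfin _ hY₂E), hY₁r, hY₂r, hd]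
          · have : (Y₁ ∪ Y₂) ∩ A = Y₁ := by
              ext z
              constructor
              · rintro ⟨hz | hz, hzA⟩
                · exact hz
                · exact absurd hzA (hY₂ hz).1.2
              · exact fun hz => ⟨Or.inl hz, (hY₁ hz).2⟩
            rw [this, hY₁r]
        obtain ⟨y, hy, h⟩ := h₁.exchange hbase' (e := x) ⟨hx.1, by
          rintro (hz | hz)
          · exact hx.2 (hY₁ hz).1
          · exact (hY₂ hz).2 rfl⟩
        refine ⟨y, ⟨?_, hy.2⟩, Or.inl h⟩
        rcases hy.1 with hz | hz
        · exact (hY₁ hz).1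
        · exact absurd (hY₂ hz).1.1 hy.2
      · have : ∃ y ∈ B₂ ∩ A, y ∉ B₁ ∩ A := by
          apply Set.exists_mem_notMem_of_ncard_lt_ncard
          · rcases hge.eq_or_lt with h | h
            · omega
            · exact absurd h₁ (by
                intro hb
                have hle : (B₁ ∩ A).encard ≤ M.eRk A :=
                  (hb.indep.inter_right A).encard_le_eRk_of_subset Set.inter_subset_right
                rw [hr, ← (hfin _ (Set.inter_subset_left.trans hB₁E)).cast_ncard_eq] at hle
                have : (B₁ ∩ A).ncard ≤ r := by exact_mod_cast hle
                omega)
          · exact hfin _ (Set.inter_subset_left.trans hB₁E)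
        obtain ⟨y, hy, hy'⟩ := this
        have hyB : y ∉ B₁ := fun h => hy' ⟨h, hy.2⟩
        obtain ⟨e1, e2, -, e4⟩ := hexch B₁ x y hB₁E hB₁k hx.1 hyB (hB₂E hy.1)
        exact ⟨y, ⟨hy.1, hyB⟩, hbig _ e1 e2 (hge.trans (e4 hy.2))⟩
  · have h₁' := ((hcusp B₁).1 h₁).2.2
    have : (B₂ \ B₁).Nonempty := by
      rw [Set.nonempty_iff_ne_empty]
      intro h0
      have hsub : B₂ ⊆ B₁ := Set.sdiff_eq_empty.1 h0
      have : B₂ = B₁ := Set.eq_of_subset_of_ncard_le hsub (by omega) (hfin B₁ hB₁E)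
      exact hx.2 (this ▸ hx.1)
    obtain ⟨y, hy⟩ := this
    obtain ⟨e1, e2, e3, -⟩ := hexch B₁ x y hB₁E hB₁k hx.1 hy.2 (hB₂E hy.1)
    exact ⟨y, hy, hbig _ e1 e2 (by omega)⟩

/-- The relaxation of `M` by a stressed subset `A`: its bases are the bases of `M` together with
the members of the cusp of `A`. -/
def relaxation {α : Type u} (M : Matroid α) [M.Finite] (A : Set α) (hA : IsStressed M A) :
    Matroid α :=
  Matroid.ofIsBaseOfFinite M.ground_finite (fun B => M.IsBase B ∨ B ∈ cusp M A)
    (let ⟨B, hB⟩ := M.exists_isBase; ⟨B, Or.inl hB⟩)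
    (relaxation_exchange hA)
    (fun _ hB => hB.elim (fun h => h.subset_ground) (fun h => h.1))

/-! ### Uniform matroids, sums of two of them, and cuspidal matroids -/

lemma uniformOn_exists {α : Type u} {E : Set α} (hE : E.Finite) (k : ℕ) :
    ∃ B : Set α, B ⊆ E ∧ B.encard = (min k E.ncard : ℕ) := by
  obtain ⟨B, hB, hBc⟩ := Set.exists_subset_card_eq (min_le_right k E.ncard)
  exact ⟨B, hB, by rw [← hBc, (hE.subset hB).cast_ncard_eq]⟩

lemma uniformOn_exchange {α : Type u} {E : Set α} (hE : E.Finite) (m : ℕ) :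
    Matroid.ExchangeProperty (fun B : Set α => B ⊆ E ∧ B.encard = m) := by
  rintro B₁ B₂ ⟨h₁, c₁⟩ ⟨h₂, c₂⟩ x hx
  have : (B₂ \ B₁).Nonempty := by
    rw [Set.nonempty_iff_ne_empty]
    intro h0
    have h := (hE.subset h₂).eq_of_subset_of_encard_le (Set.sdiff_eq_empty.1 h0)
      (by rw [c₁, c₂])
    exact hx.2 (h.symm ▸ hx.1)
  obtain ⟨y, hy⟩ := this
  exact ⟨y, hy, Set.insert_subset (h₂ hy.1) (Set.sdiff_subset.trans h₁),
    by rw [Set.encard_exchange hy.2 hx.1, c₁]⟩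

/-- The uniform matroid of rank `k` on a finite set `E`: its bases are the `k`-subsets of `E`.
(The minimum only makes the definition total; it is used for `k ≤ |E|`.) -/
def uniformOn {α : Type u} (E : Set α) (hE : E.Finite) (k : ℕ) : Matroid α :=
  Matroid.ofIsBaseOfFinite hE (fun B => B ⊆ E ∧ B.encard = (min k E.ncard : ℕ))
    (uniformOn_exists hE k) (uniformOn_exchange hE _) (fun _ hB => hB.1)

/-- The set `{a + 1, …, b}` of positive integers. -/
def interval (a b : ℕ) : Set ℕ+ := {i | a < (i : ℕ) ∧ (i : ℕ) ≤ b}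

lemma interval_finite (a b : ℕ) : (interval a b).Finite :=
  (Set.finite_Iic b).preimage (f := fun i : ℕ+ => (i : ℕ)) PNat.coe_injective.injOn |>.subset
    fun _ hi => hi.2

lemma interval_disjoint (a b c : ℕ) : Disjoint (interval a b) (interval b c) :=
  Set.disjoint_left.2 fun _ h h' => absurd h.2 (not_le.2 h'.1)

lemma uniformOn_interval_disjoint (a b c k l : ℕ) :
    Disjoint (uniformOn (interval a b) (interval_finite a b) k).E
      (uniformOn (interval b c) (interval_finite b c) l).E :=
  interval_disjoint a b c

lemma finite_disjointSum {α : Type u} {M N : Matroid α} (h : Disjoint M.E N.E)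
    (hM : M.E.Finite) (hN : N.E.Finite) : (M.disjointSum N h).E.Finite := by
  rw [Matroid.disjointSum_ground_eq]
  exact hM.union hN

/-- A matroid whose ground set is a finite set of positive integers. -/
abbrev FinMatroid := {M : Matroid ℕ+ // M.E.Finite}

/-- The uniform matroid `U_{k,n}` on `{1, …, n}`. -/
def uniform (k n : ℕ) : FinMatroid :=
  ⟨uniformOn (interval 0 n) (interval_finite 0 n) k, interval_finite 0 n⟩

/-- The direct sum `U_{k-r,n-h} ⊕ U_{r,h}`, the first summand on `{1, …, n-h}` and the second on
`{n-h+1, …, n}`. -/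
def uniformSum (r k h n : ℕ) : FinMatroid :=
  ⟨(uniformOn (interval 0 (n - h)) (interval_finite _ _) (k - r)).disjointSum
      (uniformOn (interval (n - h) n) (interval_finite _ _) r)
      (uniformOn_interval_disjoint _ _ _ _ _),
    finite_disjointSum _ (interval_finite _ _) (interval_finite _ _)⟩

lemma isStressed_disjointSum {α : Type u} {M N : Matroid α} (h : Disjoint M.E N.E)
    (hM : IsUniform M) (hN : IsUniform N) : IsStressed (M.disjointSum N h) N.E := by
  have h1 : (M.disjointSum N h).restrict N.E = N := by
    refine Matroid.ext_indep rfl fun I hI => ?_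
    have hI : I ⊆ N.E := hI
    have hIM : I ∩ M.E = ∅ := (h.symm.mono_left hI).inter_eq
    simp [Matroid.restrict_indep_iff, Matroid.disjointSum_indep_iff, hIM,
      Set.inter_eq_self_of_subset_left hI, hI, hI.trans Set.subset_union_right]
  have h2 : (M.disjointSum N h).contract N.E = M := by
    obtain ⟨J, hJ⟩ := N.exists_isBase
    have hJE := hJ.subset_ground
    have hJM : J ∩ M.E = ∅ := (h.symm.mono_left hJE).inter_eq
    have hJb : (M.disjointSum N h).IsBasis J N.E := by
      have hE : N.E ⊆ (M.disjointSum N h).E := by simp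
      rw [← Matroid.isBase_restrict_iff hE, h1]
      exact hJ
    refine Matroid.ext_indep (by simp [Set.union_sdiff_right, h.sdiff_eq_left]) fun I hI => ?_
    have hI : I ⊆ M.E := fun x hx => by
      have := hI hx
      simp only [Matroid.contract_ground, Matroid.disjointSum_ground_eq] at this
      exact this.1.resolve_right this.2
    have hIN : I ∩ N.E = ∅ := (h.mono_left hI).inter_eq
    rw [hJb.contract_indep_iff, Matroid.disjointSum_indep_iff, Set.union_inter_distrib_right,
      Set.union_inter_distrib_right, hJM, hIN, Set.inter_eq_self_of_subset_left hI,
      Set.inter_eq_self_of_subset_left hJE, Set.union_empty, Set.empty_union]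
    exact ⟨fun H => H.1.1, fun H => ⟨⟨H, hJ.indep,
      Set.union_subset_union hI hJE⟩, (h.mono_left hI).symm⟩⟩
  refine ⟨by simp, ?_, ?_⟩
  · rwa [h1]
  · rwa [h2]

lemma isStressed_uniformSum (r k h n : ℕ) :
    IsStressed (uniformSum r k h n).1 (interval (n - h) n) :=
  isStressed_disjointSum (uniformOn_interval_disjoint _ _ _ _ _) ⟨_, fun _ => Iff.rfl⟩ ⟨_, fun _ => Iff.rfl⟩

/-- The cuspidal matroid `Λ_{r,k,h,n}`: the relaxation of `U_{k-r,n-h} ⊕ U_{r,h}` by the ground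
set of the summand `U_{r,h}`. -/
def cuspidal (r k h n : ℕ) : FinMatroid :=
  haveI : (uniformSum r k h n).1.Finite := ⟨(uniformSum r k h n).2⟩
  ⟨relaxation (uniformSum r k h n).1 (interval (n - h) n) (isStressed_uniformSum r k h n),
    (uniformSum r k h n).2⟩

/-! ### Polytopes, subdivisions and valuations -/

/-- The base polytope in `ℝ^E` of a matroid with ground set `E`: the convex hull of the indicator
vectors of its bases. -/
def basePolytope {α : Type u} (E : Set α) (M : Matroid α) : Set (E → ℝ) :=
  convexHull ℝ ((fun (B : Set α) (i : E) => B.indicator (1 : α → ℝ) i) '' {B | M.IsBase B})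

/-- The dimension of a subset of a real vector space, that is, of its affine hull. -/
def dim {V : Type v} [AddCommGroup V] [Module ℝ V] (P : Set V) : ℕ :=
  Module.finrank ℝ (vectorSpan ℝ P)

/-- A polytope: the convex hull of a finite set of points. -/
def IsPolytope {V : Type v} [AddCommGroup V] [Module ℝ V] (P : Set V) : Prop :=
  ∃ T : Set V, T.Finite ∧ P = convexHull ℝ T

/-- `G` is a (possibly empty, possibly improper) face of the convex set `P`: a convex subset such
that a segment in `P` with a relatively interior point in `G` has both endpoints in `G`. -/
def IsFace {V : Type v} [AddCommGroup V] [Module ℝ V] (P G : Set V) : Prop :=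
  Convex ℝ G ∧ IsExtreme ℝ P G

/-- `S` is a subdivision of `P`: a finite collection of polytopes with union `P`, containing every
non-empty face of each of its members, such that any two different members intersect in a
(possibly empty) common face. -/
structure IsSubdivision {V : Type v} [AddCommGroup V] [Module ℝ V] (P : Set V)
    (S : Set (Set V)) : Prop where
  finite : S.Finite
  polytope : ∀ Q ∈ S, IsPolytope Q
  cover : P = ⋃₀ S
  face_mem : ∀ Q ∈ S, ∀ G, IsFace Q G → G.Nonempty → G ∈ S
  inter_face : ∀ Q ∈ S, ∀ R ∈ S, Q ≠ R → IsFace Q (Q ∩ R) ∧ IsFace R (Q ∩ R)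

/-- A map on matroids is an invariant if it takes the same value on isomorphic matroids. -/
def IsInvariant {A : Type v} (f : FinMatroid → A) : Prop :=
  ∀ M N : FinMatroid, Iso M.1 N.1 → f M = f N

open Classical in
/-- A map `f` on matroids is a valuation if, for every finite ground set `E`, every matroid `M` on
`E`, and every subdivision of the base polytope of `M` into base polytopes of matroids on `E`, the
value `f M` is the sum, with sign `(-1) ^ (codimension)`, of the values of `f` at the members of the
subdivision that are not contained in the relative boundary of the base polytope of `M`. (For a
fixed `E`, a matroid is determined by its base polytope.) -/
def IsValuation {A : Type v} [AddCommGroup A] (f : FinMatroid → A) : Prop :=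
  ∀ (E : Set ℕ+) (M : FinMatroid) (S : Finset FinMatroid),
    M.1.E = E → (∀ N ∈ S, N.1.E = E) →
    IsSubdivision (basePolytope E M.1) ((fun N : FinMatroid => basePolytope E N.1) '' S) →
    f M = ∑ N ∈ S with ¬ basePolytope E N.1 ⊆ intrinsicFrontier ℝ (basePolytope E M.1),
      (-1 : ℤ) ^ (dim (basePolytope E M.1) - dim (basePolytope E N.1)) • f N

end SplitMatroid

end

namespace SplitMatroid

open Set

/-! ### Cusps, stressed subsets and basis exchange -/

section combinatorics
variable {α : Type*} {M : Matroid α} {A A' B S : Set α} {k r : ℕ}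

/-! Let `A` be a stressed subset of rank `r`, and let `M'` be the relaxation of `M` by `A`. The
hyperplane on which the coordinates in `A` sum to `r` cuts the base polytope of `M'` into two
pieces: the base polytope of `M`, and the polytope of all `k`-sets with at least `r` elements in
`A`. The pieces meet in the polytope of the `k`-sets with exactly `r` elements in `A`; that this
slice has no other vertices is the integrality of products of hypersimplices
(`mem_convexHull_indicatorVec`). The second piece and the slice belong to matroids isomorphic to a
cuspidal matroid and to a sum of two uniform matroids, with parameters depending only on `r`, `|A|`,
`k` and `n`. Non-empty faces of base polytopes are base polytopes, so the faces of the two pieces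
form an admissible subdivision. When the cut is proper, only the pieces and the slice meet the
relative interior. Hence relaxation adds `f Λ - f (U ⊕ U)` to a valuative invariant
(`IsValuation.relaxation_eq`).

Distinct stressed subsets have disjoint cusps (`disjoint_cusp`). Relaxing one therefore leaves the
others stressed, with the same rank and cusp, and all of them can be relaxed in succession
(`IsValuation.exists_relaxation_eq`).

In an elementary split matroid every non-basis of size `k` lies in the cusp of a stressed subset, so
relaxing everything gives the uniform matroid. For a sum of two uniform matroids one of the summands
serves. For a connected split matroid, a maximal set `F` such that `M|F` is connected and `|S ∩ F| >
rk F` turns out to be a split flacet (`exists_isSplitFlacet_mem_cusp`). -/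

lemma encard_eq_iff_ncard_of_subset [M.Finite] (hS : S ⊆ M.E) (m : ℕ) :
    S.encard = m ↔ S.ncard = m := by
  rw [← (M.set_finite S hS).cast_ncard_eq]; norm_cast

lemma IsBase.ncard_eq [M.Finite] (hk : M.eRank = k) (hB : M.IsBase B) : B.ncard = k := by
  rw [← encard_eq_iff_ncard_of_subset hB.subset_ground, hB.encard_eq_eRank, hk]

lemma exists_eRank_eq (M : Matroid α) [M.Finite] : ∃ k : ℕ, M.eRank = k := by
  obtain ⟨B, hB⟩ := M.exists_isBase
  exact ⟨B.ncard, by rw [← hB.encard_eq_eRank, (M.set_finite B hB.subset_ground).cast_ncard_eq]⟩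

lemma exists_eRk_eq (M : Matroid α) [M.Finite] (A : Set α) : ∃ r : ℕ, M.eRk A = r := by
  obtain ⟨k, hk⟩ := exists_eRank_eq M
  have := M.eRk_le_eRank A
  rw [hk] at this
  exact ⟨_, (ENat.natCast_toNat (ne_top_of_le_ne_top (ENat.natCast_ne_top k) this)).symm⟩

lemma IsBase.ncard_inter_le [M.Finite] (hr : M.eRk A = r) (hB : M.IsBase B) :
    (B ∩ A).ncard ≤ r := by
  have := (hB.indep.inter_right A).encard_le_eRk_of_subset inter_subset_right
  rw [hr, ← (M.set_finite _ (inter_subset_left.trans hB.subset_ground)).cast_ncard_eq] at this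
  exact_mod_cast this

lemma exists_isBase_ncard_inter_eq [M.Finite] (hA : A ⊆ M.E) (hr : M.eRk A = r) :
    ∃ B, M.IsBase B ∧ (B ∩ A).ncard = r := by
  obtain ⟨I, hI⟩ := M.exists_isBasis A hA
  obtain ⟨B, hB, hIB⟩ := hI.indep.exists_isBase_superset
  have h := (hB.indep.inter_right A)
  have hIe : I = B ∩ A := hI.eq_of_subset_indep h (subset_inter hIB hI.subset) inter_subset_right
  refine ⟨B, hB, ?_⟩
  rw [← hIe, ← encard_eq_iff_ncard_of_subset hI.indep.subset_ground, hI.encard_eq_eRk, hr]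

lemma eRk_eq_of_forall_isBase [M.Finite] (hA : A ⊆ M.E)
    (h₁ : ∃ B, M.IsBase B ∧ (B ∩ A).ncard = r) (h₂ : ∀ B, M.IsBase B → (B ∩ A).ncard ≤ r) :
    M.eRk A = r := by
  obtain ⟨s, hs⟩ := exists_eRk_eq M A
  obtain ⟨B, hB, hBs⟩ := exists_isBase_ncard_inter_eq hA hs
  obtain ⟨B', hB', hBr⟩ := h₁
  have := h₂ B hB
  have := IsBase.ncard_inter_le hs hB'
  rw [hs, show s = r by omega]

lemma mem_cusp_iff [M.Finite] (hk : M.eRank = k) (hr : M.eRk A = r) :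
    S ∈ cusp M A ↔ S ⊆ M.E ∧ S.ncard = k ∧ r + 1 ≤ (S ∩ A).ncard := by
  simp only [cusp, Set.mem_ofPred_eq]
  refine and_congr_right fun hS => ?_
  rw [hk, hr, encard_eq_iff_ncard_of_subset hS,
    ← (M.set_finite (S ∩ A) (inter_subset_left.trans hS)).cast_ncard_eq]
  norm_cast

lemma IsStressed.isBase [M.Finite] (hA : IsStressed M A) (hk : M.eRank = k) (hr : M.eRk A = r)
    (hS : S ⊆ M.E) (hSk : S.ncard = k) (hSr : (S ∩ A).ncard = r) : M.IsBase S := by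
  refine isBase_of_isStressed hA hS ?_ ?_
  · rwa [hk, encard_eq_iff_ncard_of_subset hS]
  · rwa [hr, encard_eq_iff_ncard_of_subset (inter_subset_left.trans hS)]

/-- A set `A` of rank `r` is stressed as soon as every set of the size of a basis that meets `A`
in `r` elements is a basis. -/
lemma isStressed_of_forall_isBase [M.Finite] (hA : A ⊆ M.E) (hk : M.eRank = k) (hr : M.eRk A = r)
    (h : ∀ S ⊆ M.E, S.ncard = k → (S ∩ A).ncard = r → M.IsBase S) : IsStressed M A := by
  obtain ⟨B, hB, hBr⟩ := exists_isBase_ncard_inter_eq hA hr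
  have hBfin := M.set_finite B hB.subset_ground
  have hBk := IsBase.ncard_eq hk hB
  have hsum := ncard_inter_add_ncard_sdiff_eq_ncard B A hBfin
  -- Completing `I` by `B \ A` shows that the restriction is uniform; completing `J` by `B ∩ A`, a
  -- basis of `A`, shows it for the contraction.
  have key : ∀ I J, I ⊆ A → J ⊆ M.E \ A → I.ncard = r → J.ncard = k - r → M.IsBase (I ∪ J) := by
    intro I J hI hJ hIr hJr
    have hIA : (I ∪ J) ∩ A = I := by
      ext x
      constructor
      · rintro ⟨hx | hx, hxA⟩
        · exact hx
        · exact absurd hxA (hJ hx).2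
      · exact fun hx => ⟨Or.inl hx, hI hx⟩
    have hd : Disjoint I J := disjoint_left.2 fun x hx hx' => (hJ hx').2 (hI hx)
    have hIf := M.set_finite I (hI.trans hA)
    have hJf := M.set_finite J (hJ.trans sdiff_subset)
    refine h _ (union_subset (hI.trans hA) (hJ.trans sdiff_subset)) ?_ (by rw [hIA, hIr])
    rw [ncard_union_eq hd hIf hJf]
    omega
  have hBA : M.IsBasis (B ∩ A) A := by
    refine (hB.indep.inter_right A).isBasis_of_eRk_ge (hBfin.subset inter_subset_left)
      inter_subset_right ?_
    rw [(hB.indep.inter_right A).eRk_eq_encard, hr, (encard_eq_iff_ncard_of_subset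
      (inter_subset_left.trans hB.subset_ground) r).2 hBr]
  refine ⟨hA, ⟨r, fun I => ?_⟩, ⟨k - r, fun J => ?_⟩⟩
  · rw [Matroid.isBase_restrict_iff hA]
    constructor
    · exact fun hI => ⟨hI.subset, by rw [hI.encard_eq_eRk, hr]⟩
    · rintro ⟨hI, hIr⟩
      have hI : I ⊆ A := hI
      have := (key I (B \ A) hI (sdiff_subset_sdiff_left hB.subset_ground)
        ((encard_eq_iff_ncard_of_subset (hI.trans hA) r).1 hIr) (by omega)).indep.subset
        subset_union_left
      exact this.isBasis_of_eRk_ge (M.set_finite I (hI.trans hA)) hI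
        (by rw [this.eRk_eq_encard, hr, hIr])
  · have hJ0 : (M.contract A).IsBase (B \ A) := by
      refine Matroid.Indep.isBase_of_forall_insert ?_ ?_
      · rw [hBA.contract_indep_iff, sdiff_union_inter]
        exact ⟨hB.indep, disjoint_sdiff_right⟩
      · rintro e ⟨⟨heE, heA⟩, heB⟩ hi
        rw [hBA.contract_indep_iff, insert_union, sdiff_union_inter] at hi
        exact heB ⟨hB.mem_of_insert_indep hi.1, heA⟩
    have hcard : ∀ J, (M.contract A).IsBase J → J.encard = (k - r : ℕ) := by
      intro J hJ
      rw [hJ.encard_eq_encard_of_isBase hJ0,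
        encard_eq_iff_ncard_of_subset (sdiff_subset.trans hB.subset_ground)]
      omega
    refine ⟨fun hJ => ⟨hJ.subset_ground, hcard J hJ⟩, ?_⟩
    rintro ⟨hJ, hJr⟩
    have hJ : J ⊆ M.E \ A := hJ
    have hi : (M.contract A).Indep J := by
      rw [hBA.contract_indep_iff]
      refine ⟨?_, disjoint_left.2 fun x hx hx' => (hJ hx').2 hx⟩
      rw [union_comm]
      exact (key _ J inter_subset_right hJ hBr ((encard_eq_iff_ncard_of_subset
        (hJ.trans sdiff_subset) _).1 hJr)).indep
    obtain ⟨J', hJ', hsub⟩ := hi.exists_isBase_superset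
    rwa [(M.set_finite J (hJ.trans sdiff_subset)).eq_of_subset_of_encard_le hsub
      (by rw [hJr, hcard J' hJ'])]

/-- Distinct stressed sets with non-empty cusps have disjoint cusps. -/
lemma disjoint_cusp [M.Finite] (hA : IsStressed M A) (hA' : IsStressed M A') (hne : A ≠ A') :
    Disjoint (cusp M A) (cusp M A') := by
  obtain ⟨k, hk⟩ := exists_eRank_eq M
  obtain ⟨r, hr⟩ := exists_eRk_eq M A
  obtain ⟨r', hr'⟩ := exists_eRk_eq M A'
  rw [disjoint_left]
  intro S₀ h₀ h₀'
  have h₀ : S₀ ∈ cusp M A ∩ cusp M A' := ⟨h₀, h₀'⟩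
  obtain ⟨B, hB⟩ := M.exists_isBase
  have hBk := IsBase.ncard_eq hk hB
  have hcusp : ∀ S, S ∈ cusp M A → ¬ M.IsBase S := fun S hS hb => by
    have := IsBase.ncard_inter_le hr hb
    have := ((mem_cusp_iff hk hr).1 hS).2.2
    omega
  have hcusp' : ∀ S, S ∈ cusp M A' → ¬ M.IsBase S := fun S hS hb => by
    have := IsBase.ncard_inter_le hr' hb
    have := ((mem_cusp_iff hk hr').1 hS).2.2
    omega
  -- choose a member of both cusps closest to the basis `B`
  obtain ⟨S, hS, hmin⟩ := exists_min_image (cusp M A ∩ cusp M A') (fun S => (S \ B).ncard)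
    (M.ground_finite.finite_subsets.subset fun S hS => hS.1.1) ⟨S₀, h₀⟩
  obtain ⟨hSE, hSk, hSr⟩ := (mem_cusp_iff hk hr).1 hS.1
  obtain ⟨-, -, hSr'⟩ := (mem_cusp_iff hk hr').1 hS.2
  have hSfin := M.set_finite S hSE
  have hBfin := M.set_finite B hB.subset_ground
  have hSB : S ≠ B := fun h => hcusp S hS.1 (h ▸ hB)
  obtain ⟨x, hxS, hxB⟩ : ∃ x ∈ S, x ∉ B := by
    by_contra! h
    exact hSB (eq_of_subset_of_ncard_le h (by omega) hBfin)
  obtain ⟨y, hyB, hyS⟩ : ∃ y ∈ B, y ∉ S := by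
    by_contra! h
    exact hSB (eq_of_subset_of_ncard_le h (by omega) hSfin).symm
  -- Exchanging `u` for `v` changes `|S ∩ D|` by at most one; the indicators record the change
  -- without subtraction.
  have hcount : ∀ (D : Set α) (u v : α), u ∈ S → v ∉ S → v ∈ M.E →
      insert v (S \ {u}) ⊆ M.E ∧ (insert v (S \ {u})).ncard = k ∧
      (insert v (S \ {u}) ∩ D).ncard + (D.indicator 1 u : ℕ) =
        (S ∩ D).ncard + (D.indicator 1 v : ℕ) := by
    intro D u v hu hv hvE
    refine ⟨insert_subset hvE (sdiff_subset.trans hSE), by rw [ncard_exchange hv hu, hSk], ?_⟩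
    have h1 : ((S \ {u}) ∩ D).ncard + (D.indicator 1 u : ℕ) = (S ∩ D).ncard := by
      by_cases huD : u ∈ D
      · rw [indicator_of_mem huD, ← inter_sdiff_right_comm]
        exact ncard_sdiff_singleton_add_one ⟨hu, huD⟩ (hSfin.subset inter_subset_left)
      · rw [indicator_of_notMem huD, add_zero]
        congr 1
        ext z
        constructor
        · exact fun h => ⟨h.1.1, h.2⟩
        · exact fun h => ⟨⟨h.1, fun hz => huD (hz ▸ h.2)⟩, h.2⟩
    have h2 : (insert v (S \ {u}) ∩ D).ncard =
        ((S \ {u}) ∩ D).ncard + (D.indicator 1 v : ℕ) := by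
      by_cases hvD : v ∈ D
      · rw [indicator_of_mem hvD, insert_inter_of_mem hvD]
        exact ncard_insert_of_notMem (fun h => hv h.1.1)
          (hSfin.subset (inter_subset_left.trans sdiff_subset))
      · rw [indicator_of_notMem hvD, insert_inter_of_notMem hvD, add_zero]
    omega
  have hind : ∀ (D : Set α) (u : α), (D.indicator 1 u : ℕ) ≤ 1 := fun D u => by
    by_cases h : u ∈ D <;> simp [h]
  -- an exchange never leaves exactly one of the two cusps
  have hboth : ∀ u v, u ∈ S → v ∉ S → v ∈ M.E →
      (r + 1 ≤ (insert v (S \ {u}) ∩ A).ncard ↔ r' + 1 ≤ (insert v (S \ {u}) ∩ A').ncard) := by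
    -- A neighbour of `S` that leaves the cusp of a stressed set has exactly as many elements in
    -- that set as its rank, so it is a basis; but a member of the other cusp is never a basis.
    intro u v hu hv hvE
    obtain ⟨e1, e2, e3⟩ := hcount A u v hu hv hvE
    obtain ⟨-, -, e3'⟩ := hcount A' u v hu hv hvE
    have := hind A u
    have := hind A' u
    constructor
    · intro h
      by_contra h'
      exact hcusp _ ((mem_cusp_iff hk hr).2 ⟨e1, e2, h⟩)
        (hA'.isBase hk hr' e1 e2 (by omega))
    · intro h
      by_contra h'
      exact hcusp' _ ((mem_cusp_iff hk hr').2 ⟨e1, e2, h⟩)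
        (hA.isBase hk hr e1 e2 (by omega))
  have hyE := hB.subset_ground hyB
  obtain ⟨e1, e2, e3⟩ := hcount A x y hxS hyS hyE
  obtain ⟨-, -, e3'⟩ := hcount A' x y hxS hyS hyE
  -- Staying in the cusps would contradict minimality, since the exchange moves `S` closer to `B`.
  -- Hence `|S ∩ A| = r + 1`, `x ∈ A` and `y ∉ A`, and likewise for `A'`.
  have hout : ¬ (r + 1 ≤ (insert y (S \ {x}) ∩ A).ncard) := by
    intro h
    have h' := (hboth x y hxS hyS hyE).1 h
    have := hmin _ ⟨(mem_cusp_iff hk hr).2 ⟨e1, e2, h⟩, (mem_cusp_iff hk hr').2 ⟨e1, e2, h'⟩⟩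
    have hlt : (insert y (S \ {x}) \ B).ncard < (S \ B).ncard := by
      refine ncard_lt_ncard ⟨?_, fun h => ?_⟩ (hSfin.subset sdiff_subset)
      · rintro z ⟨rfl | hz, hzB⟩
        · exact absurd hyB hzB
        · exact ⟨hz.1, hzB⟩
      · rcases (h ⟨hxS, hxB⟩).1 with h | h
        · exact hyS (h ▸ hxS)
        · exact h.2 rfl
    omega
  have hout' : ¬ (r' + 1 ≤ (insert y (S \ {x}) ∩ A').ncard) := by
    rwa [← hboth x y hxS hyS hyE]
  have i1 := hind A x
  have i2 := hind A' x
  have hyA : y ∉ A := fun h => by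
    rw [indicator_of_mem h, Pi.one_apply] at e3
    omega
  have hyA' : y ∉ A' := fun h => by
    rw [indicator_of_mem h, Pi.one_apply] at e3'
    omega
  have hxA : x ∈ A := by
    by_contra h
    rw [indicator_of_notMem h] at e3
    omega
  have hxA' : x ∈ A' := by
    by_contra h
    rw [indicator_of_notMem h] at e3'
    omega
  rw [indicator_of_mem hxA, indicator_of_notMem hyA, Pi.one_apply] at e3
  rw [indicator_of_mem hxA', indicator_of_notMem hyA', Pi.one_apply] at e3'
  -- Membership in `A` can now be read off from exchanges. For `z ∈ S`, replacing `z` by `y` leaves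
  -- the cusp of `A` exactly when `z ∈ A`; for `z ∉ S`, replacing `x` by `z` stays in it exactly
  -- when `z ∈ A`. The same holds for `A'`, and the cusps are left simultaneously.
  apply hne
  ext z
  by_cases hzE : z ∈ M.E
  swap
  · exact ⟨fun h => absurd (hA.1 h) hzE, fun h => absurd (hA'.1 h) hzE⟩
  by_cases hzS : z ∈ S
  · have hz := hboth z y hzS hyS hyE
    obtain ⟨-, -, f⟩ := hcount A z y hzS hyS hyE
    obtain ⟨-, -, f'⟩ := hcount A' z y hzS hyS hyE
    rw [indicator_of_notMem hyA] at f
    rw [indicator_of_notMem hyA'] at f'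
    by_cases h1 : z ∈ A <;> by_cases h2 : z ∈ A' <;>
      simp only [h1, h2, indicator_of_mem, indicator_of_notMem, not_false_eq_true,
        Pi.one_apply] at f f' ⊢ <;> omega
  · have hz := hboth x z hxS hzS hzE
    obtain ⟨-, -, f⟩ := hcount A x z hxS hzS hzE
    obtain ⟨-, -, f'⟩ := hcount A' x z hxS hzS hzE
    rw [indicator_of_mem hxA, Pi.one_apply] at f
    rw [indicator_of_mem hxA', Pi.one_apply] at f'
    by_cases h1 : z ∈ A <;> by_cases h2 : z ∈ A' <;>
      simp only [h1, h2, indicator_of_mem, indicator_of_notMem, not_false_eq_true,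
        Pi.one_apply] at f f' ⊢ <;> omega

/-- Symmetric basis exchange. -/
lemma IsBase.symm_exchange {B₁ B₂ : Set α} (h₁ : M.IsBase B₁) (h₂ : M.IsBase B₂) {x : α}
    (hx : x ∈ B₁ \ B₂) :
    ∃ y ∈ B₂ \ B₁, M.IsBase (insert y (B₁ \ {x})) ∧ M.IsBase (insert x (B₂ \ {y})) := by
  have hxE := h₁.subset_ground hx.1
  have hC := h₂.fundCircuit_isCircuit hxE hx.2
  have hCsub := M.fundCircuit_subset_insert x B₂
  -- If the fundamental circuit of `x` minus `x` lay in the closure of `B₁ \ {x}`, so would `x`,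
  -- against the independence of `B₁`.
  obtain ⟨y, hyC, hy⟩ : ∃ y ∈ M.fundCircuit x B₂ \ {x}, y ∉ M.closure (B₁ \ {x}) := by
    by_contra! h
    have h1 : x ∈ M.closure (M.fundCircuit x B₂ \ {x}) :=
      hC.mem_closure_sdiff_singleton_of_mem (M.mem_fundCircuit x B₂)
    have h2 := M.closure_subset_closure_of_subset_closure (fun y hy => h y hy) h1
    exact h₁.indep.notMem_closure_sdiff_of_mem hx.1 h2
  have hyB₂ : y ∈ B₂ := (hCsub hyC.1).resolve_left hyC.2
  have hyE := h₂.subset_ground hyB₂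
  have hyB₁ : y ∉ B₁ := fun h => hy (M.mem_closure_of_mem' ⟨h, hyC.2⟩ hyE)
  refine ⟨y, ⟨hyB₂, hyB₁⟩, ?_, ?_⟩
  · exact h₁.exchange_base_of_notMem_closure hx.1 hy hyE
  · rw [insert_sdiff_singleton_comm (by rintro rfl; exact hyB₁ hx.1)]
    refine h₂.exchange_isBase_of_indep' hyB₂ hx.2 ?_
    exact (h₂.indep.mem_fundCircuit_iff (by rwa [h₂.closure_eq]) hx.2).1 hyC.1

end combinatorics

/-! ### Relative interiors and hyperplane cuts of convex sets -/

section convexity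
variable {V : Type*}

section algebraic
variable [AddCommGroup V] [Module ℝ V] {P Q : Set V} {l : V →ₗ[ℝ] ℝ} {c : ℝ} {x y z : V}

/-- `x` is a core point of `P` if every segment in `P` with endpoint `x` can be prolonged beyond
`x` inside `P`. -/
def IsCore (P : Set V) (x : V) : Prop :=
  x ∈ P ∧ ∀ y ∈ P, ∃ z ∈ P, x ∈ openSegment ℝ y z

lemma IsCore.of_mem_openSegment (hP : Convex ℝ P) (hx : IsCore P x) (hy : y ∈ P)
    (hz : z ∈ openSegment ℝ x y) : IsCore P z := by
  refine ⟨hP.openSegment_subset hx.1 hy hz, fun u hu => ?_⟩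
  obtain ⟨v, hv, a, b, ha, hb, hab, hxe⟩ := hx.2 u hu
  obtain ⟨s, t, hs, ht, hst, hze⟩ := hz
  have hpos : 0 < s * b + t := by positivity
  -- From `x = a u + b v` and `z = s x + t y` one gets `z = s a u + (s b v + t y)`; the prolongation
  -- is the normalized bracket.
  refine ⟨(s * b / (s * b + t)) • v + (t / (s * b + t)) • y,
    hP hv hy (by positivity) (by positivity) (by field_simp), s * a, s * b + t, by positivity,
    hpos, by linear_combination s * hab + hst, ?_⟩
  rw [smul_add, smul_smul, smul_smul, mul_div_cancel₀ _ hpos.ne', mul_div_cancel₀ _ hpos.ne',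
    ← hze, ← hxe]
  module

/-- Pulling the far endpoint in towards `x` keeps `x` strictly between. This is used when a
prolongation crosses the cutting hyperplane and has to be stopped there. -/
lemma mem_openSegment_of_mem_openSegment (hx : x ∈ openSegment ℝ y z) {w : V}
    (hw : w ∈ openSegment ℝ x z) : x ∈ openSegment ℝ y w := by
  obtain ⟨a, b, ha, hb, hab, hx⟩ := hx
  obtain ⟨s, t, hs, ht, hst, hw⟩ := hw
  have hpos : 0 < a * t + b := by positivity
  refine ⟨a * t / (a * t + b), b / (a * t + b), by positivity, by positivity, by field_simp, ?_⟩
  have h : (a * t + b) • x = (a * t) • y + b • w := by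
    have e : t • x = t • (a • y + b • z) := by rw [hx]
    have e2 : b • w = b • (s • x + t • z) := by rw [hw]
    have e3 : a * t + b = t + b * s := by linear_combination t * hab - b * hst
    rw [e3, e2, add_smul, e]
    module
  calc _ = (a * t + b)⁻¹ • ((a * t) • y + b • w) := by
        rw [smul_add, smul_smul, smul_smul, div_eq_inv_mul, div_eq_inv_mul]
    _ = x := by rw [← h, inv_smul_smul₀ hpos.ne']

lemma exists_mem_openSegment_apply_eq (hx : l x < c) (hy : c < l y) :
    ∃ z ∈ openSegment ℝ x y, l z = c := by
  have h : 0 < l y - l x := by linarith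
  refine ⟨((l y - c) / (l y - l x)) • x + ((c - l x) / (l y - l x)) • y,
    ⟨_, _, div_pos (by linarith) h, div_pos (by linarith) h, by field_simp; ring, rfl⟩, ?_⟩
  simp only [map_add, map_smul, smul_eq_mul]
  field_simp
  ring

lemma isFace_setOf_eq (hP : Convex ℝ P) :
    IsFace {x ∈ P | l x ≤ c} {x ∈ P | l x = c} := by
  refine ⟨?_, fun x hx => ⟨hx.1, hx.2.le⟩, ?_⟩
  · exact hP.inter (convex_hyperplane l.isLinear c)
  · rintro x hx y hy z hz ⟨a, b, ha, hb, hab, rfl⟩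
    refine ⟨hx.1, le_antisymm hx.2 ?_⟩
    have h := hz.2
    simp only [map_add, map_smul, smul_eq_mul] at h
    have h2 := hy.2
    by_contra! h3
    have : a * l x < a * c := mul_lt_mul_of_pos_left h3 ha
    have : b * l y ≤ b * c := mul_le_mul_of_nonneg_left h2 hb.le
    have : a * c + b * c = c := by rw [← add_mul, hab, one_mul]
    linarith

/-- A face of one half of a convex set that contains a core point of the whole set is either that
half or the cut. -/
lemma IsFace.eq_or_eq_of_isCore (hP : Convex ℝ P) (hQ : IsFace {x ∈ P | l x ≤ c} Q)
    (hxQ : x ∈ Q) (hx : IsCore P x) :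
    Q = {x ∈ P | l x ≤ c} ∨ Q = {x ∈ P | l x = c} := by
  -- A core point strictly inside the half lies between any `y` of the half and a point `z` of `P`,
  -- which may be replaced by the crossing point when it overshoots; extremality then puts `y` in
  -- `Q`.
  have key : ∀ x ∈ Q, IsCore P x → l x < c → Q = {x ∈ P | l x ≤ c} := by
    intro x hxQ hx hlt
    refine hQ.2.subset.antisymm fun y hy => ?_
    obtain ⟨z, hz, hxz⟩ := hx.2 y hy.1
    rcases le_or_gt (l z) c with h | h
    · exact hQ.2.left_mem_of_mem_openSegment hy ⟨hz, h⟩ hxQ hxz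
    · obtain ⟨w, hw, hwc⟩ := exists_mem_openSegment_apply_eq hlt h
      exact hQ.2.left_mem_of_mem_openSegment hy
        ⟨hP.openSegment_subset hx.1 hz hw, hwc.le⟩ hxQ (mem_openSegment_of_mem_openSegment hxz hw)
  rcases (hQ.2.subset hxQ).2.lt_or_eq with hlt | heq
  · exact Or.inl (key x hxQ hx hlt)
  by_cases h : ∃ q ∈ Q, l q < c
  · obtain ⟨q, hq, hqc⟩ := h
    -- The midpoint is again a core point and lies strictly inside the half, so `key` applies to it.
    have hm : (1 / 2 : ℝ) • x + (1 / 2 : ℝ) • q ∈ openSegment ℝ x q :=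
      ⟨1 / 2, 1 / 2, by norm_num, by norm_num, by norm_num, rfl⟩
    refine Or.inl (key _ (hQ.1.openSegment_subset hxQ hq hm)
      (hx.of_mem_openSegment hP (hQ.2.subset hq).1 hm) ?_)
    simp only [map_add, map_smul, smul_eq_mul]
    linarith
  · push Not at h
    refine Or.inr (subset_antisymm (fun q hq =>
      ⟨(hQ.2.subset hq).1, le_antisymm (hQ.2.subset hq).2 (h q hq)⟩) fun y hy => ?_)
    obtain ⟨z, hz, hxz⟩ := hx.2 y hy.1
    -- A segment with one endpoint and an interior point on the hyperplane stays in the hyperplane.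
    have hzc : l z = c := by
      obtain ⟨a, b, ha, hb, hab, rfl⟩ := hxz
      simp only [map_add, map_smul, smul_eq_mul] at heq
      rw [hy.2] at heq
      have : b * (l z - c) = 0 := by linear_combination heq - c * hab
      rcases mul_eq_zero.1 this with h | h
      · exact absurd h hb.ne'
      · linarith
    exact hQ.2.left_mem_of_mem_openSegment ⟨hy.1, hy.2.le⟩ ⟨hz, hzc.le⟩ hxQ hxz

/-- An open segment from a core point to any point of `P` consists of core points, so a core point
can be slid onto the hyperplane from either side. -/
lemma exists_isCore_apply_eq (hP : Convex ℝ P) (hx : IsCore P x) (hy : y ∈ P) (hyc : l y < c)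
    (hz : z ∈ P) (hzc : c < l z) : ∃ w, IsCore P w ∧ l w = c := by
  rcases lt_trichotomy (l x) c with h | h | h
  · obtain ⟨w, hw, hwc⟩ := exists_mem_openSegment_apply_eq h hzc
    exact ⟨w, hx.of_mem_openSegment hP hz hw, hwc⟩
  · exact ⟨x, hx, h⟩
  · obtain ⟨w, hw, hwc⟩ := exists_mem_openSegment_apply_eq hyc h
    rw [openSegment_symm] at hw
    exact ⟨w, hx.of_mem_openSegment hP hy hw, hwc⟩

lemma vectorSpan_setOf_le (hP : Convex ℝ P) (hx : x ∈ P) (hxc : l x < c) :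
    vectorSpan ℝ {x ∈ P | l x ≤ c} = vectorSpan ℝ P := by
  refine le_antisymm (vectorSpan_mono ℝ (sep_subset _ _)) ?_
  rw [vectorSpan_eq_span_vsub_set_right ℝ hx, Submodule.span_le]
  rintro _ ⟨y, hy, rfl⟩
  -- Since `x` is strictly inside, every `y` can be pulled towards `x` into the half, which only
  -- rescales the direction `y - x`.
  obtain ⟨t, ht, ht1, htc⟩ : ∃ t : ℝ, 0 < t ∧ t ≤ 1 ∧ l x + t * (l y - l x) ≤ c := by
    rcases le_or_gt (l y) c with h | h
    · exact ⟨1, one_pos, le_rfl, by linarith⟩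
    · have : 0 < l y - l x := by linarith
      refine ⟨(c - l x) / (l y - l x), div_pos (by linarith) this, ?_, ?_⟩
      · rw [div_le_one this]; linarith
      · field_simp; linarith
  have hmem : x + t • (y - x) ∈ {x ∈ P | l x ≤ c} :=
    ⟨hP.add_smul_sub_mem hx hy ⟨ht.le, ht1⟩, by simpa using htc⟩
  have h := vsub_mem_vectorSpan ℝ hmem (show x ∈ {x ∈ P | l x ≤ c} from ⟨hx, hxc.le⟩)
  have e : (x + t • (y - x)) -ᵥ x = t • (y - x) := by simp
  rw [e] at h
  simpa [smul_smul, inv_mul_cancel₀ ht.ne'] using Submodule.smul_mem _ t⁻¹ h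

/-- Directions to points of `P` generate the span. Convexity of `P` handles sums, and the
prolongation property of a core point handles negative multiples. -/
lemma IsCore.exists_add_smul_mem (hP : Convex ℝ P) (hx : IsCore P x) {w : V}
    (hw : w ∈ vectorSpan ℝ P) : ∃ t : ℝ, 0 < t ∧ x + t • w ∈ P := by
  rw [vectorSpan_eq_span_vsub_set_right ℝ hx.1] at hw
  induction hw using Submodule.span_induction with
  | mem w hw =>
    obtain ⟨y, hy, rfl⟩ := hw
    exact ⟨1, one_pos, by simpa using hy⟩
  | zero => exact ⟨1, one_pos, by simpa using hx.1⟩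
  | add v w _ _ hv hw =>
    obtain ⟨s, hs, hv⟩ := hv
    obtain ⟨t, ht, hw⟩ := hw
    -- The weights `t / (s + t)` and `s / (s + t)` give `s v` and `t w` the same coefficient.
    refine ⟨s * t / (s + t), by positivity, ?_⟩
    have := hP hv hw (a := t / (s + t)) (b := s / (s + t)) (by positivity) (by positivity)
      (by field_simp; ring)
    convert this using 1
    have e : (t / (s + t)) + (s / (s + t)) = 1 := by field_simp; ring
    have e1 : (t / (s + t)) * s = s * t / (s + t) := by ring
    have e2 : (s / (s + t)) * t = s * t / (s + t) := by ring
    simp only [smul_add, smul_smul, e1, e2]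
    rw [add_add_add_comm, ← add_smul, e, one_smul]
  | smul a w _ hw =>
    obtain ⟨t, ht, hw⟩ := hw
    rcases lt_trichotomy a 0 with ha | rfl | ha
    -- Here `x = s (x + t w) + u z`, so `z = x - (s t / u) w`; dividing by `-a > 0` writes this as a
    -- positive multiple of `a w`.
    · obtain ⟨z, hz, s, u, hs, hu, hsu, h⟩ := hx.2 _ hw
      refine ⟨s * t / (u * -a), div_pos (by positivity) (mul_pos hu (by linarith)), ?_⟩
      have hz' : z = x + (s * t / (u * -a)) • a • w := by
        have e : u • z = u • (x + (s * t / (u * -a)) • a • w) := by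
          have e1 : u * (s * t / (u * -a)) * a = - (s * t) := by
            have := ha.ne
            field_simp
          rw [smul_add, smul_smul, smul_smul, e1]
          have e2 : u • z = x - s • (x + t • w) := by rw [eq_sub_iff_add_eq, add_comm, h]
          rw [e2]
          have : s = 1 - u := by linarith
          subst this
          module
        simpa only [inv_smul_smul₀ hu.ne'] using congrArg (u⁻¹ • ·) e
      rwa [← hz']
    · exact ⟨1, one_pos, by simpa using hx.1⟩
    · refine ⟨t / a, div_pos ht ha, ?_⟩
      rwa [smul_smul, div_mul_cancel₀ _ ha.ne']

/-- From a core point on the hyperplane, a small step in any direction of the span that `l` kills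
stays in the slice. Without a core point the slice could be too small. -/
lemma vectorSpan_setOf_eq (hP : Convex ℝ P) (hx : IsCore P x) (hxc : l x = c) :
    vectorSpan ℝ {x ∈ P | l x = c} = vectorSpan ℝ P ⊓ LinearMap.ker l := by
  refine le_antisymm (le_inf (vectorSpan_mono ℝ (sep_subset _ _)) ?_) ?_
  · rw [vectorSpan_def, Submodule.span_le]
    rintro _ ⟨y, hy, z, hz, rfl⟩
    simp [hy.2, hz.2]
  · rintro w ⟨hw, hwl⟩
    obtain ⟨t, ht, hmem⟩ := hx.exists_add_smul_mem hP hw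
    have hwl : l w = 0 := hwl
    have h := vsub_mem_vectorSpan ℝ
      (show x + t • w ∈ {x ∈ P | l x = c} from ⟨hmem, by simp [hwl, hxc]⟩)
      (show x ∈ {x ∈ P | l x = c} from ⟨hx.1, hxc⟩)
    have e : (x + t • w) -ᵥ x = t • w := by simp
    rw [e] at h
    simpa [smul_smul, inv_mul_cancel₀ ht.ne'] using Submodule.smul_mem _ t⁻¹ h

lemma dim_setOf_le (hP : Convex ℝ P) (hx : x ∈ P) (hxc : l x < c) :
    dim {x ∈ P | l x ≤ c} = dim P := by
  rw [dim, dim, vectorSpan_setOf_le hP hx hxc]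

/-- Rank-nullity for `l` on the direction space of `P`, where `l` is non-zero because it separates
`x` from `y`. -/
lemma dim_setOf_eq [FiniteDimensional ℝ V] (hP : Convex ℝ P) (hx : IsCore P x) (hxc : l x = c)
    (hy : y ∈ P) (hyc : l y < c) : dim P = dim {x ∈ P | l x = c} + 1 := by
  rw [dim, dim, vectorSpan_setOf_eq hP hx hxc]
  set W := vectorSpan ℝ P
  have hyx : x -ᵥ y ∈ W := vsub_mem_vectorSpan ℝ hx.1 hy
  have h1 := LinearMap.finrank_range_add_finrank_ker (l.domRestrict W)
  have h2 : Module.finrank ℝ (LinearMap.range (l.domRestrict W)) = 1 := by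
    have : LinearMap.range (l.domRestrict W) = ⊤ := by
      apply LinearMap.range_eq_top.2
      apply LinearMap.surjective
      intro h0
      have := LinearMap.congr_fun h0 ⟨_, hyx⟩
      simp only [LinearMap.domRestrict_apply, vsub_eq_sub, map_sub, LinearMap.zero_apply] at this
      linarith
    rw [this, finrank_top, Module.finrank_self]
  have h3 : Module.finrank ℝ (LinearMap.ker (l.domRestrict W)) =
      Module.finrank ℝ ↥(W ⊓ LinearMap.ker l) := by
    have e : (LinearMap.ker (l.domRestrict W)).map W.subtype = W ⊓ LinearMap.ker l := by
      ext w
      simp [and_comm]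
    rw [← e]
    exact (Submodule.finrank_map_subtype_eq W _).symm
  omega

end algebraic

section topological
variable [NormedAddCommGroup V] [NormedSpace ℝ V] {P : Set V} {x : V}

lemma mem_intrinsicInterior_iff_exists_isOpen :
    x ∈ intrinsicInterior ℝ P ↔
      x ∈ P ∧ ∃ O : Set V, IsOpen O ∧ x ∈ O ∧ O ∩ affineSpan ℝ P ⊆ P := by
  rw [mem_intrinsicInterior]
  constructor
  · rintro ⟨y, hy, rfl⟩
    obtain ⟨U, hU, hUo, hyU⟩ := mem_interior.1 hy
    obtain ⟨O, hO, rfl⟩ := isOpen_induced_iff.1 hUo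
    exact ⟨interior_subset (s := Subtype.val ⁻¹' P) hy, O, hO, hyU, fun z hz => hU (show (⟨z, hz.2⟩ : affineSpan ℝ P) ∈ _ from hz.1)⟩
  · rintro ⟨hxP, O, hO, hxO, hsub⟩
    refine ⟨⟨x, subset_affineSpan ℝ P hxP⟩, mem_interior.2 ⟨Subtype.val ⁻¹' O, ?_, ?_, hxO⟩, rfl⟩
    · exact fun z hz => hsub ⟨hz, z.2⟩
    · exact hO.preimage continuous_subtype_val

/-- If `x` is a core point, prolong a segment from a relative interior point `p` through `x` to `z`;
the homothety centred at `z` taking `p` to `x` carries a neighbourhood of `p` in `P` to one of `x`.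
Conversely, a neighbourhood of `x` contains points slightly beyond `x` on the line from `y`. -/
lemma isCore_iff_mem_intrinsicInterior [FiniteDimensional ℝ V] (hP : Convex ℝ P) :
    IsCore P x ↔ x ∈ intrinsicInterior ℝ P := by
  constructor
  · intro hx
    obtain ⟨p, hp⟩ := Set.Nonempty.intrinsicInterior hP ⟨x, hx.1⟩
    obtain ⟨hpP, O, hO, hpO, hsub⟩ := mem_intrinsicInterior_iff_exists_isOpen.1 hp
    obtain ⟨z, hz, a, b, ha, hb, hab, hxe⟩ := hx.2 p hpP
    have hback : ∀ w : V, a • AffineMap.lineMap z w a⁻¹ + b • z = w := by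
      intro w
      have hb' : b = 1 - a := by linarith
      rw [AffineMap.lineMap_apply_module, smul_add, smul_smul, smul_smul, mul_inv_cancel₀ ha.ne',
        mul_sub, mul_inv_cancel₀ ha.ne', hb']
      module
    refine mem_intrinsicInterior_iff_exists_isOpen.2
      ⟨hx.1, (fun w => AffineMap.lineMap z w a⁻¹) ⁻¹' O, hO.preimage ?_, ?_, ?_⟩
    · simp only [AffineMap.lineMap_apply_module]
      fun_prop
    · have : AffineMap.lineMap z x a⁻¹ = p := by
        have h := (hback x).trans hxe.symm
        have := add_right_cancel h
        simpa [smul_smul, inv_mul_cancel₀ ha.ne'] using congrArg (a⁻¹ • ·) this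
      change AffineMap.lineMap z x a⁻¹ ∈ O
      rwa [this]
    · rintro w ⟨hwO, hw⟩
      have := hsub ⟨hwO, AffineMap.lineMap_mem a⁻¹ (subset_affineSpan ℝ P hz) hw⟩
      rw [← hback w]
      exact hP this hz ha.le hb.le hab
  · intro hx
    obtain ⟨hxP, O, hO, hxO, hsub⟩ := mem_intrinsicInterior_iff_exists_isOpen.1 hx
    refine ⟨hxP, fun y hy => ?_⟩
    have hcont : Continuous fun t : ℝ => AffineMap.lineMap y x (1 + t) := by
      simp only [AffineMap.lineMap_apply_module]
      fun_prop
    have hev : ∀ᶠ t in nhds (0 : ℝ), AffineMap.lineMap y x (1 + t) ∈ O :=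
      hcont.continuousAt.eventually (hO.mem_nhds (by simpa using hxO))
    obtain ⟨t, htO, ht⟩ := ((hev.filter_mono nhdsWithin_le_nhds).and
      (self_mem_nhdsWithin (a := (0 : ℝ)) (s := Ioi 0))).exists
    have ht : 0 < t := ht
    refine ⟨_, hsub ⟨htO, AffineMap.lineMap_mem _ (subset_affineSpan ℝ P hy)
      (subset_affineSpan ℝ P hxP)⟩, t / (1 + t), 1 / (1 + t), by positivity, by positivity,
      by field_simp; ring, ?_⟩
    rw [AffineMap.lineMap_apply_module, smul_add, smul_smul, smul_smul, ← add_assoc, ← add_smul]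
    have e1 : t / (1 + t) + 1 / (1 + t) * (1 - (1 + t)) = 0 := by field_simp; ring
    have e2 : 1 / (1 + t) * (1 + t) = 1 := by field_simp
    rw [e1, e2, zero_smul, one_smul, zero_add]

/-- This translates the boundary condition of `IsValuation` into a purely algebraic one. -/
lemma not_subset_intrinsicFrontier_iff [FiniteDimensional ℝ V] (hP : Convex ℝ P) {Q : Set V}
    (hQ : Q ⊆ P) : ¬ Q ⊆ intrinsicFrontier ℝ P ↔ ∃ x ∈ Q, IsCore P x := by
  rw [not_subset]
  refine exists_congr fun x => and_congr_right fun hx => ?_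
  rw [isCore_iff_mem_intrinsicInterior hP]
  constructor
  · intro h
    have := subset_intrinsicClosure (𝕜 := ℝ) (hQ hx)
    rw [← intrinsicInterior_union_intrinsicFrontier] at this
    exact this.resolve_right h
  · intro h h'
    rw [← intrinsicClosure_sdiff_intrinsicFrontier] at h
    exact h.2 h'

lemma exists_isCore [FiniteDimensional ℝ V] (hP : Convex ℝ P) (hne : P.Nonempty) :
    ∃ x, IsCore P x := by
  obtain ⟨x, hx⟩ := hne.intrinsicInterior hP
  exact ⟨x, (isCore_iff_mem_intrinsicInterior hP).2 hx⟩

end topological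

section subdivision
variable [AddCommGroup V] [Module ℝ V] {P : Set V} {l : V →ₗ[ℝ] ℝ} {c : ℝ}

lemma IsFace.trans {Q R : Set V} (h₁ : IsFace P Q) (h₂ : IsFace Q R) : IsFace P R :=
  ⟨h₂.1, h₁.2.trans h₂.2⟩

lemma IsFace.inter {Q R : Set V} (h₁ : IsFace P Q) (h₂ : IsFace P R) : IsFace P (Q ∩ R) :=
  ⟨h₁.1.inter h₂.1, h₁.2.inter h₂.2⟩

lemma IsFace.mono {Q R : Set V} (h : IsFace P R) (hQ : Q ⊆ P) (hR : R ⊆ Q) : IsFace Q R :=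
  ⟨h.1, h.2.mono hQ hR⟩

/-- The non-empty faces of two polytopes that meet in a common face form a subdivision of their
union. -/
lemma isSubdivision_union {P₁ P₂ : Set V} {S : Set (Set V)} (hP₁ : IsFace P₁ P₁)
    (hP₂ : IsFace P₂ P₂) (hne₁ : P₁.Nonempty) (hne₂ : P₂.Nonempty)
    (h₁ : IsFace P₁ (P₁ ∩ P₂)) (h₂ : IsFace P₂ (P₁ ∩ P₂))
    (hS : ∀ Q, Q ∈ S ↔ Q.Nonempty ∧ (IsFace P₁ Q ∨ IsFace P₂ Q))
    (hfin : S.Finite) (hpol : ∀ Q ∈ S, IsPolytope Q) (hP : P = P₁ ∪ P₂) : IsSubdivision P S := by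
  -- A face `R` of `P₂` meets `P₁` in its intersection with the common face, which is a face of the
  -- common face and hence of `P₁`.
  have hmix : ∀ {P₁ P₂ Q R : Set V}, IsFace P₁ (P₁ ∩ P₂) → IsFace P₂ (P₁ ∩ P₂) → IsFace P₁ Q →
      IsFace P₂ R → IsFace P₁ (Q ∩ R) := by
    intro P₁ P₂ Q R h₁ h₂ hQ hR
    have hR' : IsFace P₁ (R ∩ (P₁ ∩ P₂)) :=
      h₁.trans ((hR.inter h₂).mono inter_subset_right inter_subset_right)
    have : Q ∩ R = Q ∩ (R ∩ (P₁ ∩ P₂)) := by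
      ext x
      constructor
      · exact fun h => ⟨h.1, h.2, hQ.2.subset h.1, hR.2.subset h.2⟩
      · exact fun h => ⟨h.1, h.2.1⟩
    rw [this]
    exact hQ.inter hR'
  have h₁' : IsFace P₁ (P₂ ∩ P₁) := inter_comm P₁ P₂ ▸ h₁
  have h₂' : IsFace P₂ (P₂ ∩ P₁) := inter_comm P₁ P₂ ▸ h₂
  have hboth : ∀ {Q R : Set V}, IsFace P₁ Q ∨ IsFace P₂ Q → IsFace P₁ R ∨ IsFace P₂ R →
      IsFace Q (Q ∩ R) := by
    rintro Q R (hQ | hQ) (hR | hR)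
    · exact (hQ.inter hR).mono hQ.2.subset inter_subset_left
    · exact (hmix h₁ h₂ hQ hR).mono hQ.2.subset inter_subset_left
    · exact (hmix h₂' h₁' hQ hR).mono hQ.2.subset inter_subset_left
    · exact (hQ.inter hR).mono hQ.2.subset inter_subset_left
  refine ⟨hfin, hpol, ?_, ?_, ?_⟩
  · rw [hP]
    refine subset_antisymm (union_subset (subset_sUnion_of_mem ((hS _).2 ⟨hne₁, Or.inl hP₁⟩))
      (subset_sUnion_of_mem ((hS _).2 ⟨hne₂, Or.inr hP₂⟩))) (sUnion_subset fun Q hQ => ?_)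
    rcases ((hS Q).1 hQ).2 with h | h
    · exact h.2.subset.trans subset_union_left
    · exact h.2.subset.trans subset_union_right
  · intro Q hQ G hG hGne
    exact (hS G).2 ⟨hGne, ((hS Q).1 hQ).2.imp (fun h => h.trans hG) (fun h => h.trans hG)⟩
  · intro Q hQ R hR _
    refine ⟨hboth ((hS Q).1 hQ).2 ((hS R).1 hR).2, ?_⟩
    rw [inter_comm]
    exact hboth ((hS R).1 hR).2 ((hS Q).1 hQ).2

end subdivision
end convexity

/-! ### Integrality of products of hypersimplices -/

section hypersimplex
variable {ι β : Type*} [Fintype ι]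

open Classical in
/-- A product of hypersimplices: the points of the unit cube with prescribed coordinate sums over
the blocks of a partition. -/
def hypersimplexProd (p : ι → β) (m : β → ℕ) : Set (ι → ℝ) :=
  {x | (∀ i, 0 ≤ x i ∧ x i ≤ 1) ∧ ∀ b, ∑ i with p i = b, x i = m b}

open Classical in
-- A fractional coordinate forces a second one in its block, because the block sum is an integer.
-- Shifting a small amount between the two, in either direction, exhibits the point as a midpoint.
lemma hypersimplexProd_eq_zero_or_one_of_mem_extremePoints {p : ι → β} {m : β → ℕ} {x : ι → ℝ}
    (hx : x ∈ (hypersimplexProd p m).extremePoints ℝ) (i : ι) : x i = 0 ∨ x i = 1 := by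
  obtain ⟨⟨h01, hsum⟩, hext⟩ := hx
  by_contra! hi
  have hi0 : 0 < x i := (h01 i).1.lt_of_ne' hi.1
  have hi1 : x i < 1 := (h01 i).2.lt_of_ne hi.2
  obtain ⟨j, hji, hpj, hj0, hj1⟩ : ∃ j, j ≠ i ∧ p j = p i ∧ 0 < x j ∧ x j < 1 := by
    -- Otherwise all other coordinates of the block are integers, and so is `x i`, which lies
    -- strictly between `0` and `1`.
    by_contra! h
    have hz : ∀ j, ∃ z : ℤ, j ≠ i → p j = p i → x j = z := by
      intro j
      by_cases h1 : j ≠ i ∧ p j = p i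
      · rcases (h01 j).1.eq_or_lt with h2 | h2
        · exact ⟨0, fun _ _ => by simp [← h2]⟩
        · exact ⟨1, fun _ _ => by simpa using le_antisymm (h01 j).2 (h j h1.1 h1.2 h2)⟩
      · exact ⟨0, fun h2 h3 => absurd ⟨h2, h3⟩ h1⟩
    choose z hz using hz
    have hs := hsum (p i)
    rw [← Finset.add_sum_erase (Finset.univ.filter fun j => p j = p i) _
        (Finset.mem_filter.2 ⟨Finset.mem_univ i, rfl⟩),
      Finset.sum_congr rfl (g := fun j => (z j : ℝ)) (fun j hj => by
        simp only [Finset.mem_erase, Finset.mem_filter] at hj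
        exact hz j hj.1 hj.2.2)] at hs
    rw [← Int.cast_sum] at hs
    set t := ∑ j ∈ (Finset.univ.filter fun j => p j = p i).erase i, z j
    have e : x i = ((m (p i) - t : ℤ) : ℝ) := by push_cast; linarith
    rw [e] at hi0 hi1
    have a1 : (0 : ℤ) < m (p i) - t := by exact_mod_cast hi0
    have a2 : (m (p i) - t : ℤ) < 1 := by exact_mod_cast hi1
    omega
  obtain ⟨e, he, e1, e2, e3, e4⟩ : ∃ e : ℝ, 0 < e ∧ e ≤ x i ∧ e ≤ 1 - x i ∧ e ≤ x j ∧
      e ≤ 1 - x j :=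
    ⟨min (min (x i) (1 - x i)) (min (x j) (1 - x j)),
      lt_min (lt_min hi0 (by linarith)) (lt_min hj0 (by linarith)),
      (min_le_left _ _).trans (min_le_left _ _), (min_le_left _ _).trans (min_le_right _ _),
      (min_le_right _ _).trans (min_le_left _ _), (min_le_right _ _).trans (min_le_right _ _)⟩
  have hmem : ∀ d : ℝ, |d| ≤ e →
      (x + d • (Pi.single i 1 - Pi.single j 1) : ι → ℝ) ∈ hypersimplexProd p m := by
    intro d hd
    obtain ⟨hd1, hd2⟩ := abs_le.1 hd
    refine ⟨fun a => ?_, fun b => ?_⟩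
    · by_cases hai : a = i
      · subst hai
        simp only [Pi.add_apply, Pi.smul_apply, Pi.sub_apply, Pi.single_eq_same,
          Pi.single_eq_of_ne hji.symm, smul_eq_mul]
        constructor <;> linarith
      · by_cases haj : a = j
        · subst haj
          simp only [Pi.add_apply, Pi.smul_apply, Pi.sub_apply, Pi.single_eq_same,
            Pi.single_eq_of_ne hai, smul_eq_mul]
          constructor <;> linarith
        · simpa [Pi.single_eq_of_ne hai, Pi.single_eq_of_ne haj] using h01 a
    · simp only [Pi.add_apply, Pi.smul_apply, Pi.sub_apply, smul_eq_mul]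
      rw [Finset.sum_add_distrib, hsum b, ← Finset.mul_sum, Finset.sum_sub_distrib]
      have hs : ∀ a : ι, ∑ k with p k = b, (Pi.single a 1 : ι → ℝ) k = if p a = b then 1 else 0 := by
        intro a
        rw [Finset.sum_filter, Finset.sum_eq_single a (fun k _ hk => by simp [hk]) (by simp)]
        simp
      rw [hs, hs, hpj, sub_self, mul_zero, add_zero]
  have h := hext (hmem e (abs_of_pos he).le) (hmem (-e) (by rw [abs_neg, abs_of_pos he]))
    ⟨1 / 2, 1 / 2, by norm_num, by norm_num, by norm_num, by module⟩
  have := congrFun h i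
  simp only [Pi.add_apply, Pi.smul_apply, Pi.sub_apply, Pi.single_eq_same,
    Pi.single_eq_of_ne hji.symm, smul_eq_mul] at this
  linarith

lemma convex_hypersimplexProd (p : ι → β) (m : β → ℕ) : Convex ℝ (hypersimplexProd p m) := by
  rintro x ⟨hx, hxs⟩ y ⟨hy, hys⟩ a b ha hb hab
  refine ⟨fun i => ⟨?_, ?_⟩, fun c => ?_⟩
  · have := (hx i).1; have := (hy i).1
    simp only [Pi.add_apply, Pi.smul_apply, smul_eq_mul]
    positivity
  · simp only [Pi.add_apply, Pi.smul_apply, smul_eq_mul]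
    have := mul_le_mul_of_nonneg_left (hx i).2 ha
    have := mul_le_mul_of_nonneg_left (hy i).2 hb
    linarith
  · simp only [Pi.add_apply, Pi.smul_apply, smul_eq_mul]
    rw [Finset.sum_add_distrib, ← Finset.mul_sum, ← Finset.mul_sum, hxs, hys, ← add_mul, hab,
      one_mul]

lemma isCompact_hypersimplexProd (p : ι → β) (m : β → ℕ) : IsCompact (hypersimplexProd p m) := by
  classical
  have : hypersimplexProd p m = Icc 0 1 ∩ ⋂ b, {x : ι → ℝ | ∑ i with p i = b, x i = m b} := by
    ext x
    simp [hypersimplexProd, Pi.le_def, forall_and, and_assoc]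
  rw [this]
  refine isCompact_Icc.inter_right (isClosed_iInter fun b => isClosed_eq ?_ continuous_const)
  fun_prop

open Classical in
/-- A product of hypersimplices is the convex hull of its points with coordinates `0` and `1`. -/
lemma hypersimplexProd_subset_convexHull (p : ι → β) (m : β → ℕ) :
    hypersimplexProd p m ⊆
      convexHull ℝ {x | x ∈ hypersimplexProd p m ∧ ∀ i, x i = 0 ∨ x i = 1} := by
  have hfin : {x : ι → ℝ | x ∈ hypersimplexProd p m ∧ ∀ i, x i = 0 ∨ x i = 1}.Finite := by
    refine (Set.Finite.pi (t := fun _ : ι => ({0, 1} : Set ℝ)) fun _ => Set.toFinite _).subset ?_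
    exact fun x hx i _ => hx.2 i
  -- Krein–Milman; the closure is harmless because there are only finitely many points with
  -- coordinates `0` and `1`.
  conv_lhs => rw [← closure_convexHull_extremePoints (isCompact_hypersimplexProd p m)
    (convex_hypersimplexProd p m)]
  refine closure_minimal (convexHull_mono fun x hx => ⟨hx.1,
    hypersimplexProd_eq_zero_or_one_of_mem_extremePoints hx⟩) ?_
  exact hfin.isClosed_convexHull ℝ

end hypersimplex

/-! ### Faces and halves of convex hulls -/

section convexity
variable {V : Type*} [AddCommGroup V] [Module ℝ V]

/-- By extremality, the points of the hull that lie in `convexHull ℝ (T ∩ G)` as soon as they lie in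
`G` form a convex set; it contains `T`. -/
lemma IsExtreme.subset_convexHull_inter {T G : Set V} (h : IsExtreme ℝ (convexHull ℝ T) G) :
    G ⊆ convexHull ℝ (T ∩ G) := by
  have key : convexHull ℝ T ⊆ {x | x ∈ convexHull ℝ T ∧ (x ∈ G → x ∈ convexHull ℝ (T ∩ G))} := by
    refine convexHull_min (fun x hx => ⟨subset_convexHull ℝ T hx, fun hG =>
      subset_convexHull ℝ _ ⟨hx, hG⟩⟩) ?_
    rw [convex_iff_openSegment_subset]
    intro x hx y hy z hz
    refine ⟨(convex_convexHull ℝ T).openSegment_subset hx.1 hy.1 hz, fun hG => ?_⟩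
    exact (convex_convexHull ℝ (T ∩ G)).openSegment_subset
      (hx.2 (h.left_mem_of_mem_openSegment hx.1 hy.1 hG hz))
      (hy.2 (h.right_mem_of_mem_openSegment hx.1 hy.1 hG hz)) hz
  exact fun x hx => (key (h.subset hx)).2 hx

/-- A point `x` of the half lies on a segment from `a ∈ C₁` to `b ∈ C₂`. That segment crosses the
hyperplane at a point that `hc` places in `C₁`, and `x` lies between it and `a`. -/
lemma setOf_mem_convexHull_union_le {C₁ C₂ : Set V} {l : V →ₗ[ℝ] ℝ} {c : ℝ} (h₁ : Convex ℝ C₁)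
    (h₂ : Convex ℝ C₂) (hne₁ : C₁.Nonempty) (hne₂ : C₂.Nonempty) (hl₁ : ∀ x ∈ C₁, l x ≤ c)
    (hl₂ : ∀ x ∈ C₂, c ≤ l x) (hc : ∀ x ∈ convexHull ℝ (C₁ ∪ C₂), l x = c → x ∈ C₁) :
    {x ∈ convexHull ℝ (C₁ ∪ C₂) | l x ≤ c} = C₁ := by
  have hconv := convex_convexHull ℝ (C₁ ∪ C₂)
  have hsub := subset_convexHull ℝ (C₁ ∪ C₂)
  refine subset_antisymm ?_ fun x hx => ⟨hsub (Or.inl hx), hl₁ x hx⟩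
  rintro x ⟨hx, hxc⟩
  have hx' := hx
  rw [h₁.convexHull_union h₂ hne₁ hne₂, mem_convexJoin] at hx'
  obtain ⟨a, ha, b, hb, hxab⟩ := hx'
  rcases hxc.eq_or_lt with h | h
  · exact hc x hx h
  rcases (hl₂ b hb).eq_or_lt with h' | h'
  · exact h₁.segment_subset ha (hc b (hsub (Or.inr hb)) h'.symm) hxab
  obtain ⟨w, hw, hwc⟩ := exists_mem_openSegment_apply_eq h h'
  have hwC := hc w (hconv.openSegment_subset hx (hsub (Or.inr hb)) hw) hwc
  by_cases hxa : x = a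
  · rwa [hxa]
  have hxb : x ≠ b := by rintro rfl; linarith
  have := mem_openSegment_of_ne_left_right (Ne.symm hxa) hxb.symm hxab
  exact h₁.openSegment_subset ha hwC (mem_openSegment_of_mem_openSegment this hw)

end convexity

/-! ### Base polytopes and their faces -/

section basePolytope
variable {α : Type*} {E A B : Set α} {M N : Matroid α}

/-- The indicator vector in `ℝ^E` of a set `B`. -/
noncomputable def indicatorVec (E B : Set α) : E → ℝ := fun i => B.indicator (1 : α → ℝ) i

lemma basePolytope_eq (E : Set α) (M : Matroid α) :
    basePolytope E M = convexHull ℝ (indicatorVec E '' {B | M.IsBase B}) := rfl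

lemma IsBase.indicatorVec_mem (hB : M.IsBase B) : indicatorVec E B ∈ basePolytope E M :=
  subset_convexHull ℝ _ ⟨B, hB, rfl⟩

lemma convex_basePolytope : Convex ℝ (basePolytope E M) := convex_convexHull ℝ _

lemma basePolytope_nonempty : (basePolytope E M).Nonempty :=
  let ⟨_, hB⟩ := M.exists_isBase
  ⟨_, IsBase.indicatorVec_mem hB⟩

lemma indicatorVec_injOn : InjOn (indicatorVec E) {B | B ⊆ E} := by
  intro B hB B' hB' h
  ext x
  by_cases hx : x ∈ E
  · have := congrFun h ⟨x, hx⟩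
    simp only [indicatorVec, indicator, Pi.one_apply] at this
    split_ifs at this <;> simp_all
  · exact ⟨fun h => absurd (hB h) hx, fun h => absurd (hB' h) hx⟩

lemma basePolytope_subset_Icc : basePolytope E M ⊆ Icc 0 1 := by
  refine convexHull_min ?_ (convex_Icc 0 1)
  rintro _ ⟨B, -, rfl⟩
  exact ⟨fun i => indicator_nonneg (fun _ _ => zero_le_one) _,
    fun i => indicator_le_self' (fun _ _ => zero_le_one) _⟩

lemma indicatorVec_mem_extremePoints (E B : Set α) :
    indicatorVec E B ∈ (Icc (0 : E → ℝ) 1).extremePoints ℝ := by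
  rw [mem_extremePoints_iff_left]
  refine ⟨⟨fun i => indicator_nonneg (fun _ _ => zero_le_one) _,
    fun i => indicator_le_self' (fun _ _ => zero_le_one) _⟩, ?_⟩
  rintro x ⟨hx0, hx1⟩ y ⟨hy0, hy1⟩ ⟨a, b, ha, hb, hab, h⟩
  ext i
  have hi := congrFun h i
  have h0 : (0 : ℝ) ≤ x i := hx0 i
  have h1 : x i ≤ 1 := hx1 i
  have h2 : (0 : ℝ) ≤ y i := hy0 i
  have h3 : y i ≤ 1 := hy1 i
  simp only [Pi.add_apply, Pi.smul_apply, smul_eq_mul] at hi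
  by_cases hB : (i : α) ∈ B
  · have e : indicatorVec E B i = 1 := indicator_of_mem hB _
    rw [e] at hi ⊢
    have := mul_le_mul_of_nonneg_left h3 hb.le
    have : a * (1 - x i) ≤ 0 := by linarith
    nlinarith
  · have e : indicatorVec E B i = 0 := indicator_of_notMem hB _
    rw [e] at hi ⊢
    have := mul_nonneg hb.le h2
    have : a * x i ≤ 0 := by linarith
    nlinarith

/-- A vertex of the cube is a vertex of every subpolytope containing it, and the vertices of a
convex hull are among its generators. So the polytope remembers the bases. -/
lemma isBase_of_indicatorVec_mem (hE : M.E ⊆ E) (hB : B ⊆ E)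
    (h : indicatorVec E B ∈ basePolytope E M) : M.IsBase B := by
  have h1 : indicatorVec E B ∈ (basePolytope E M).extremePoints ℝ :=
    inter_extremePoints_subset_extremePoints_of_subset basePolytope_subset_Icc
      ⟨h, indicatorVec_mem_extremePoints E B⟩
  obtain ⟨B', hB', he⟩ := extremePoints_convexHull_subset h1
  have hB' : M.IsBase B' := hB'
  rwa [← indicatorVec_injOn (hB'.subset_ground.trans hE) hB he]

lemma eq_of_basePolytope_eq (hM : M.E = E) (hN : N.E = E)
    (h : basePolytope E M = basePolytope E N) : M = N := by
  refine Matroid.ext_isBase (hM.trans hN.symm) fun B hB => ?_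
  rw [hM] at hB
  exact ⟨fun hb => isBase_of_indicatorVec_mem hN.le hB (h ▸ IsBase.indicatorVec_mem hb),
    fun hb => isBase_of_indicatorVec_mem hM.le hB (h ▸ IsBase.indicatorVec_mem hb)⟩

lemma isPolytope_basePolytope (hE : E.Finite) (hM : M.E ⊆ E) : IsPolytope (basePolytope E M) :=
  ⟨_, (hE.finite_subsets.subset fun _ hB => (Matroid.IsBase.subset_ground hB).trans hM).image _, rfl⟩

/-- Every non-empty face of a base polytope is a base polytope. -/
lemma IsFace.exists_eq_basePolytope (hE : E.Finite) (hM : M.E = E) {G : Set (E → ℝ)}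
    (hG : IsFace (basePolytope E M) G) (hne : G.Nonempty) :
    ∃ N : Matroid α, N.E = E ∧ basePolytope E N = G := by
  have hGeq : G = convexHull ℝ (indicatorVec E '' {B | M.IsBase B} ∩ G) :=
    (IsExtreme.subset_convexHull_inter hG.2).antisymm (convexHull_min inter_subset_right hG.1)
  have himg : indicatorVec E '' {B | M.IsBase B} ∩ G =
      indicatorVec E '' {B | M.IsBase B ∧ indicatorVec E B ∈ G} := by
    ext x
    constructor
    · rintro ⟨⟨B, hB, rfl⟩, hx⟩
      exact ⟨B, ⟨hB, hx⟩, rfl⟩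
    · rintro ⟨B, ⟨hB, hx⟩, rfl⟩
      exact ⟨⟨B, hB, rfl⟩, hx⟩
  rw [himg] at hGeq
  -- Symmetric exchange preserves the sum of the two indicator vectors. The common midpoint lies in
  -- `G`, so extremality puts the exchanged bases on the face too.
  have hex : Matroid.ExchangeProperty (fun B => M.IsBase B ∧ indicatorVec E B ∈ G) := by
    rintro B₁ B₂ ⟨h₁, g₁⟩ ⟨h₂, g₂⟩ x hx
    obtain ⟨y, hy, hb₁, hb₂⟩ := IsBase.symm_exchange h₁ h₂ hx
    refine ⟨y, hy, hb₁, ?_⟩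
    have hmid : (1 / 2 : ℝ) • indicatorVec E B₁ + (1 / 2 : ℝ) • indicatorVec E B₂ =
        (1 / 2 : ℝ) • indicatorVec E (insert y (B₁ \ {x})) +
          (1 / 2 : ℝ) • indicatorVec E (insert x (B₂ \ {y})) := by
      ext i
      have hxy : x ≠ y := by rintro rfl; exact hx.2 hy.1
      have hx1 := hx.1
      have hx2 := hx.2
      have hy1 := hy.1
      have hy2 := hy.2
      by_cases hix : (i : α) = x
      · simp [indicatorVec, indicator, hix, hx1, hx2, hxy]
      by_cases hiy : (i : α) = y
      · simp [indicatorVec, indicator, hiy, hy1, hy2, hxy.symm]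
      · have e₁ : (i : α) ∈ insert y (B₁ \ {x}) ↔ (i : α) ∈ B₁ := by simp [hix, hiy]
        have e₂ : (i : α) ∈ insert x (B₂ \ {y}) ↔ (i : α) ∈ B₂ := by simp [hix, hiy]
        have e : ∀ {C D : Set α}, ((i : α) ∈ C ↔ (i : α) ∈ D) →
            indicatorVec E C i = indicatorVec E D i := fun {C D} h => by
          by_cases hi : (i : α) ∈ D
          · exact (indicator_of_mem (h.2 hi) _).trans (indicator_of_mem hi _).symm
          · exact (indicator_of_notMem (fun hC => hi (h.1 hC)) _).trans
              (indicator_of_notMem hi _).symm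
        simp only [Pi.add_apply, Pi.smul_apply, e e₁, e e₂]
    have hmem : (1 / 2 : ℝ) • indicatorVec E B₁ + (1 / 2 : ℝ) • indicatorVec E B₂ ∈ G :=
      hG.1 g₁ g₂ (by norm_num) (by norm_num) (by norm_num)
    rw [hmid] at hmem
    exact hG.2.left_mem_of_mem_openSegment (IsBase.indicatorVec_mem hb₁)
      (IsBase.indicatorVec_mem hb₂) hmem ⟨1 / 2, 1 / 2, by norm_num, by norm_num, by norm_num, rfl⟩
  have hne' : ∃ B, M.IsBase B ∧ indicatorVec E B ∈ G := by
    rw [hGeq, convexHull_nonempty_iff] at hne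
    obtain ⟨_, B, hB, -⟩ := hne
    exact ⟨B, hB⟩
  refine ⟨Matroid.ofIsBaseOfFinite hE (fun B => M.IsBase B ∧ indicatorVec E B ∈ G) hne' hex
    (fun B hB => hM ▸ hB.1.subset_ground), rfl, ?_⟩
  rw [basePolytope_eq]
  exact hGeq.symm

end basePolytope

/-! ### Coordinate sums over subsets -/

section mass
variable {α : Type*} {E A B : Set α} [Fintype E]

open Classical in
/-- The sum of the coordinates indexed by `A`. -/
noncomputable def massOn (A : Set α) : (E → ℝ) →ₗ[ℝ] ℝ :=
  ∑ i ∈ Finset.univ.filter (fun i : E => (i : α) ∈ A), LinearMap.proj i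

open Classical in
lemma massOn_apply (A : Set α) (x : E → ℝ) : massOn A x = ∑ i ∈ Finset.univ.filter (fun i : E => (i : α) ∈ A), x i := by
  simp [massOn]

lemma massOn_indicatorVec (hB : B ⊆ E) (A : Set α) :
    massOn A (indicatorVec E B) = ((B ∩ A).ncard : ℝ) := by
  classical
  have h : B ∩ A = Subtype.val '' {i : E | (i : α) ∈ A ∧ (i : α) ∈ B} := by
    ext x
    constructor
    · exact fun hx => ⟨⟨x, hB hx.1⟩, ⟨hx.2, hx.1⟩, rfl⟩
    · rintro ⟨i, hi, rfl⟩
      exact ⟨hi.2, hi.1⟩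
  rw [massOn_apply, h, ncard_image_of_injective _ Subtype.val_injective, ncard_eq_toFinset_card']
  have : ∀ i : E, indicatorVec E B i = if (i : α) ∈ B then 1 else 0 := fun i => by
    by_cases hi : (i : α) ∈ B <;> simp [indicatorVec, hi]
  simp only [this]
  rw [← Finset.sum_filter, Finset.filter_filter, Finset.sum_const, nsmul_eq_mul, mul_one]
  congr 2
  ext i
  simp [and_comm]

open Classical in
lemma massOn_add_massOn_compl (A : Set α) (x : E → ℝ) :
    massOn A x + massOn Aᶜ x = massOn univ x := by
  simp only [massOn_apply, mem_compl_iff, mem_univ, Finset.filter_true]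
  exact Finset.sum_filter_add_sum_filter_not _ _ _

/-- The points of the unit cube with prescribed integral coordinate sums over `A` and over all of
`E` are convex combinations of the indicator vectors with these coordinate sums. -/
lemma mem_convexHull_indicatorVec {k r : ℕ} (hrk : r ≤ k) {x : E → ℝ} (hx : x ∈ Icc 0 1)
    (hk : massOn univ x = k) (hr : massOn A x = r) :
    x ∈ convexHull ℝ (indicatorVec E '' {S | S ⊆ E ∧ S.ncard = k ∧ (S ∩ A).ncard = r}) := by
  classical
  -- There are two blocks, `A` and its complement, labelled by truth values, with sums `r` and `k -
  -- r`; `hrk` makes the natural subtraction exact.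
  set p : E → Prop := fun i => (i : α) ∈ A
  set m : Prop → ℕ := fun b => if b then r else k - r
  have hmem : ∀ y : E → ℝ, y ∈ hypersimplexProd p m ↔
      y ∈ Icc 0 1 ∧ massOn univ y = k ∧ massOn A y = r := by
    intro y
    have h1 : y ∈ Icc 0 1 ↔ ∀ i, 0 ≤ y i ∧ y i ≤ 1 := by simp [Pi.le_def, forall_and]
    have h2 : ∀ _ : DecidablePred fun i => p i = True, ∑ i with p i = True, y i = massOn A y :=
      fun _ => by
        rw [massOn_apply]
        exact Finset.sum_congr (by ext; simp [p]) fun _ _ => rfl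
    have h3 : ∀ _ : DecidablePred fun i => p i = False, ∑ i with p i = False, y i = massOn Aᶜ y :=
      fun _ => by
        rw [massOn_apply]
        exact Finset.sum_congr (by ext; simp [p]) fun _ _ => rfl
    have hs := massOn_add_massOn_compl A y
    rw [h1]
    refine and_congr_right fun _ => ?_
    constructor
    · intro h
      have a := h True
      have b := h False
      rw [h2 _] at a
      rw [h3 _] at b
      simp only [m, if_true, if_false] at a b
      push_cast [hrk] at b
      exact ⟨by linarith, a⟩
    · rintro ⟨a, b⟩ c
      by_cases hc : c
      · rw [eq_true hc, h2 _]; simpa [m] using b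
      · rw [eq_false hc, h3 _]; simp only [m, if_false]; push_cast [hrk]; linarith
  refine convexHull_mono ?_ (hypersimplexProd_subset_convexHull p m ((hmem x).2 ⟨hx, hk, hr⟩))
  rintro y ⟨hy, h01⟩
  obtain ⟨-, hyk, hyr⟩ := (hmem y).1 hy
  have hS : (Subtype.val '' {i : E | y i = 1}) ⊆ E := by
    rintro _ ⟨i, -, rfl⟩; exact i.2
  have hyS : indicatorVec E (Subtype.val '' {i : E | y i = 1}) = y := by
    ext i
    rcases h01 i with h | h <;> simp [indicatorVec, h]
  rw [← hyS, massOn_indicatorVec hS] at hyk hyr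
  refine ⟨_, ⟨hS, ?_, by exact_mod_cast hyr⟩, hyS⟩
  rw [inter_univ] at hyk
  exact_mod_cast hyk

end mass

/-! ### Cutting the base polytope of a relaxation -/

section cut
variable {α : Type*} {E A : Set α} {M M' L N : Matroid α} {k r : ℕ}

lemma massOn_univ_eq_of_mem_basePolytope [Fintype E] (hE : M.E ⊆ E) (hM : ∀ B, M.IsBase B → B.ncard = k)
    {x : E → ℝ} (hx : x ∈ basePolytope E M) : massOn univ x = k := by
  have : basePolytope E M ⊆ {x | massOn univ x = (k : ℝ)} := by
    refine convexHull_min ?_ (convex_hyperplane (massOn univ).isLinear _)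
    rintro _ ⟨B, hB, rfl⟩
    have hB : M.IsBase B := hB
    change massOn univ (indicatorVec E B) = (k : ℝ)
    rw [massOn_indicatorVec (hB.subset_ground.trans hE), inter_univ, hM B hB]
  exact this hx

lemma massOn_le_of_mem_basePolytope [Fintype E] (hE : M.E ⊆ E) (hM : ∀ B, M.IsBase B → (B ∩ A).ncard ≤ r)
    {x : E → ℝ} (hx : x ∈ basePolytope E M) : massOn A x ≤ r := by
  have : basePolytope E M ⊆ {x | massOn A x ≤ (r : ℝ)} := by
    refine convexHull_min ?_ (convex_halfSpace_le (massOn A).isLinear _)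
    rintro _ ⟨B, hB, rfl⟩
    have hB : M.IsBase B := hB
    change massOn A (indicatorVec E B) ≤ (r : ℝ)
    rw [massOn_indicatorVec (hB.subset_ground.trans hE)]
    exact_mod_cast hM B hB
  exact this hx

lemma le_massOn_of_mem_basePolytope [Fintype E] (hE : M.E ⊆ E) (hM : ∀ B, M.IsBase B → r ≤ (B ∩ A).ncard)
    {x : E → ℝ} (hx : x ∈ basePolytope E M) : r ≤ massOn A x := by
  have : basePolytope E M ⊆ {x | (r : ℝ) ≤ massOn A x} := by
    refine convexHull_min ?_ (convex_halfSpace_ge (massOn A).isLinear _)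
    rintro _ ⟨B, hB, rfl⟩
    have hB : M.IsBase B := hB
    change (r : ℝ) ≤ massOn A (indicatorVec E B)
    rw [massOn_indicatorVec (hB.subset_ground.trans hE)]
    exact_mod_cast hM B hB
  exact this hx

/-- `M'` is obtained from `M` by adding as bases all the `k`-sets with more than `r` elements in
`A`; the bases of `L` and `N` are the `k`-sets with at least, respectively exactly, `r` elements in
`A`. -/
structure IsRelaxationCut (E A : Set α) (k r : ℕ) (M M' L N : Matroid α) : Prop where
  ground : M.E = E
  ground' : M'.E = E
  groundL : L.E = E
  groundN : N.E = E
  card : ∀ B, M.IsBase B → B.ncard = k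
  le : ∀ B, M.IsBase B → (B ∩ A).ncard ≤ r
  isBase_iff : ∀ B, M'.IsBase B ↔ M.IsBase B ∨ (B ⊆ E ∧ B.ncard = k ∧ r + 1 ≤ (B ∩ A).ncard)
  isBaseL_iff : ∀ B, L.IsBase B ↔ B ⊆ E ∧ B.ncard = k ∧ r ≤ (B ∩ A).ncard
  isBaseN_iff : ∀ B, N.IsBase B ↔ B ⊆ E ∧ B.ncard = k ∧ (B ∩ A).ncard = r
  isBase_of : ∀ B, N.IsBase B → M.IsBase B

namespace IsRelaxationCut
lemma basePolytope_eq_convexHull_union (h : IsRelaxationCut E A k r M M' L N) :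
    basePolytope E M' = convexHull ℝ (basePolytope E M ∪ basePolytope E L) := by
  rw [basePolytope_eq E M, basePolytope_eq E L, convexHull_convexHull_union_left,
    convexHull_convexHull_union_right, ← image_union, basePolytope_eq]
  congr 2
  ext B
  simp only [mem_ofPred_eq, mem_union, h.isBase_iff, h.isBaseL_iff]
  constructor
  · exact Or.imp id fun hB => ⟨hB.1, hB.2.1, by omega⟩
  · rintro (hB | hB)
    · exact Or.inl hB
    · rcases hB.2.2.eq_or_lt with h' | h'
      · exact Or.inl (h.isBase_of B ((h.isBaseN_iff B).2 ⟨hB.1, hB.2.1, h'.symm⟩))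
      · exact Or.inr ⟨hB.1, hB.2.1, h'⟩

lemma isBaseL_of (h : IsRelaxationCut E A k r M M' L N) (B : Set α) (hB : N.IsBase B) : L.IsBase B := by
  rw [h.isBaseL_iff]
  rw [h.isBaseN_iff] at hB
  exact ⟨hB.1, hB.2.1, hB.2.2.ge⟩

variable [Fintype E]

lemma le_rank (h : IsRelaxationCut E A k r M M' L N) : r ≤ k := by
  obtain ⟨B, hB⟩ := N.exists_isBase
  obtain ⟨hB, h1, h2⟩ := (h.isBaseN_iff B).1 hB
  rw [← h1, ← h2]
  exact ncard_le_ncard inter_subset_left (E.toFinite.subset hB)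

/-- The slice consists of points of the cube with integral sums over `A` and over `E`, so
integrality makes it the hull of the `k`-sets meeting `A` in `r` elements. -/
lemma basePolytopeN_eq (h : IsRelaxationCut E A k r M M' L N) :
    basePolytope E N = {x ∈ basePolytope E M' | massOn A x = r} := by
  have hcard' : ∀ B, M'.IsBase B → B.ncard = k := fun B hB =>
    ((h.isBase_iff B).1 hB).elim (h.card B) (fun h' => h'.2.1)
  apply subset_antisymm
  · intro x hx
    exact ⟨convexHull_mono (image_mono fun B hB => (h.isBase_iff B).2 (Or.inl (h.isBase_of B hB))) hx,
      le_antisymm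
        (massOn_le_of_mem_basePolytope h.groundN.le (fun B hB => ((h.isBaseN_iff B).1 hB).2.2.le) hx)
        (le_massOn_of_mem_basePolytope h.groundN.le
          (fun B hB => ((h.isBaseN_iff B).1 hB).2.2.ge) hx)⟩
  · rintro x ⟨hx, hxr⟩
    refine convexHull_mono (image_mono fun B hB => (h.isBaseN_iff B).2 hB)
      (mem_convexHull_indicatorVec h.le_rank (basePolytope_subset_Icc hx)
        (massOn_univ_eq_of_mem_basePolytope h.ground'.le hcard' hx) hxr)

/-- The polytope of `M'` is the hull of those of `M` and `L`, which lie on opposite sides of the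
hyperplane, and the slice is contained in the polytope of `M`. -/
lemma basePolytope_eq (h : IsRelaxationCut E A k r M M' L N) :
    basePolytope E M = {x ∈ basePolytope E M' | massOn A x ≤ r} := by
  rw [h.basePolytope_eq_convexHull_union]
  refine (setOf_mem_convexHull_union_le convex_basePolytope convex_basePolytope
    basePolytope_nonempty basePolytope_nonempty
    (fun x => massOn_le_of_mem_basePolytope h.ground.le h.le)
    (fun x => le_massOn_of_mem_basePolytope h.groundL.le
      fun B hB => ((h.isBaseL_iff B).1 hB).2.2) fun x hx hxr => ?_).symm
  rw [← h.basePolytope_eq_convexHull_union] at hx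
  exact convexHull_mono (image_mono h.isBase_of) (h.basePolytopeN_eq.ge ⟨hx, hxr⟩)

/-- The functional is negated so that the results on halves of the form `l x ≤ c` cover this side as
well. -/
lemma basePolytopeL_eq (h : IsRelaxationCut E A k r M M' L N) :
    basePolytope E L = {x ∈ basePolytope E M' | (-massOn A : (E → ℝ) →ₗ[ℝ] ℝ) x ≤ -(r : ℝ)} := by
  rw [h.basePolytope_eq_convexHull_union, union_comm]
  refine (setOf_mem_convexHull_union_le convex_basePolytope convex_basePolytope
    basePolytope_nonempty basePolytope_nonempty (fun x hx => ?_) (fun x hx => ?_)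
    fun x hx hxr => ?_).symm
  · rw [LinearMap.neg_apply, neg_le_neg_iff]
    exact le_massOn_of_mem_basePolytope h.groundL.le (fun B hB => ((h.isBaseL_iff B).1 hB).2.2) hx
  · rw [LinearMap.neg_apply, neg_le_neg_iff]
    exact massOn_le_of_mem_basePolytope h.ground.le h.le hx
  · rw [union_comm, ← h.basePolytope_eq_convexHull_union] at hx
    rw [LinearMap.neg_apply, neg_inj] at hxr
    exact convexHull_mono (image_mono h.isBaseL_of) (h.basePolytopeN_eq.ge ⟨hx, hxr⟩)

lemma basePolytopeN_eq_neg (h : IsRelaxationCut E A k r M M' L N) :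
    basePolytope E N =
      {x ∈ basePolytope E M' | (-massOn A : (E → ℝ) →ₗ[ℝ] ℝ) x = -(r : ℝ)} := by
  simp only [LinearMap.neg_apply, neg_inj]
  exact h.basePolytopeN_eq

end IsRelaxationCut
end cut

/-! ### Valuations on a polytope cut in two -/

section valuation
variable {G : Type*} [AddCommGroup G] {f : FinMatroid → G} {E A : Set ℕ+} {k r : ℕ}
  {M M' L N : FinMatroid}

lemma finite_setOf_ground_eq {E : Set ℕ+} (hE : E.Finite) : {N : FinMatroid | N.1.E = E}.Finite := by
  refine Set.Finite.of_finite_image (f := fun N : FinMatroid => {B | N.1.IsBase B})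
    (hE.finite_subsets.finite_subsets.subset ?_) ?_
  · rintro _ ⟨N, hN, rfl⟩ B hB
    have hN : N.1.E = E := hN
    exact hN ▸ Matroid.IsBase.subset_ground hB
  · intro N hN N' hN' h
    have hN : N.1.E = E := hN
    have hN' : N'.1.E = E := hN'
    exact Subtype.ext (Matroid.ext_isBase (hN.trans hN'.symm) fun B _ => Set.ext_iff.1 h B)

/-- A valuation applied to a matroid whose base polytope is cut in two by a hyperplane. -/
lemma IsValuation.eq_add_sub_of_exists (hval : IsValuation f)
    (h : IsRelaxationCut E A k r M.1 M'.1 L.1 N.1)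
    (hu : ∃ B, M.1.IsBase B ∧ (B ∩ A).ncard < r)
    (hv : ∃ B ⊆ E, B.ncard = k ∧ r < (B ∩ A).ncard) :
    f M' = f M + f L - f N := by
  classical
  obtain ⟨U, hU, hUr⟩ := hu
  obtain ⟨W, hWE, hWk, hWr⟩ := hv
  have hEfin : E.Finite := h.ground ▸ M.2
  have : Fintype E := hEfin.fintype
  have hUE : U ⊆ E := h.ground ▸ hU.subset_ground
  have hU' : M'.1.IsBase U := (h.isBase_iff U).2 (Or.inl hU)
  have hW' : M'.1.IsBase W := (h.isBase_iff W).2 (Or.inr ⟨hWE, hWk, hWr⟩)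
  have hWL : L.1.IsBase W := (h.isBaseL_iff W).2 ⟨hWE, hWk, hWr.le⟩
  set P := basePolytope E M'.1
  have hP : Convex ℝ P := convex_basePolytope
  set l : (E → ℝ) →ₗ[ℝ] ℝ := massOn A
  have eM := h.basePolytope_eq
  have eL := h.basePolytopeL_eq
  have eN := h.basePolytopeN_eq
  have eN' := h.basePolytopeN_eq_neg
  have hlu : l (indicatorVec E U) < r := by
    rw [massOn_indicatorVec hUE]; exact_mod_cast hUr
  have hlw : (r : ℝ) < l (indicatorVec E W) := by
    rw [massOn_indicatorVec hWE]; exact_mod_cast hWr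
  have hNM : basePolytope E M.1 ∩ basePolytope E L.1 = basePolytope E N.1 := by
    rw [eM, eL, eN]
    ext x
    simp only [mem_inter_iff, mem_ofPred_eq, LinearMap.neg_apply, neg_le_neg_iff]
    exact ⟨fun hx => ⟨hx.1.1, le_antisymm hx.1.2 hx.2.2⟩, fun hx => ⟨⟨hx.1, hx.2.le⟩, hx.1, hx.2.ge⟩⟩
  have fM : IsFace (basePolytope E M.1) (basePolytope E N.1) := by
    rw [eM, eN]; exact isFace_setOf_eq hP
  have fL : IsFace (basePolytope E L.1) (basePolytope E N.1) := by
    rw [eL, eN']; exact isFace_setOf_eq hP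
  have fMM : IsFace (basePolytope E M.1) (basePolytope E M.1) :=
    ⟨convex_basePolytope, IsExtreme.rfl⟩
  have fLL : IsFace (basePolytope E L.1) (basePolytope E L.1) :=
    ⟨convex_basePolytope, IsExtreme.rfl⟩
  have sM : basePolytope E M.1 ⊆ P := by rw [eM]; exact sep_subset _ _
  have sL : basePolytope E L.1 ⊆ P := by rw [eL]; exact sep_subset _ _
  -- The subdivision consists of all non-empty faces of both pieces, each represented by its unique
  -- matroid on `E`.
  have hSfin : {N' : FinMatroid | N'.1.E = E ∧ (IsFace (basePolytope E M.1) (basePolytope E N'.1) ∨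
      IsFace (basePolytope E L.1) (basePolytope E N'.1))}.Finite :=
    (finite_setOf_ground_eq hEfin).subset fun N' hN' => hN'.1
  set S := hSfin.toFinset
  have hS : ∀ N' : FinMatroid, N' ∈ S ↔ N'.1.E = E ∧
      (IsFace (basePolytope E M.1) (basePolytope E N'.1) ∨
        IsFace (basePolytope E L.1) (basePolytope E N'.1)) := fun N' => hSfin.mem_toFinset
  have hsub : IsSubdivision P ((fun N' : FinMatroid => basePolytope E N'.1) '' S) := by
    refine isSubdivision_union fMM fLL basePolytope_nonempty basePolytope_nonempty
      (hNM ▸ fM) (hNM ▸ fL) (fun Q => ?_) (S.finite_toSet.image _) ?_ ?_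
    · constructor
      · rintro ⟨N', hN', rfl⟩
        exact ⟨basePolytope_nonempty, ((hS N').1 hN').2⟩
      · rintro ⟨hne, hQ⟩
        obtain ⟨N', hN', rfl⟩ : ∃ N' : Matroid ℕ+, N'.E = E ∧ basePolytope E N' = Q :=
          hQ.elim (fun hQ => hQ.exists_eq_basePolytope hEfin h.ground hne)
            (fun hQ => hQ.exists_eq_basePolytope hEfin h.groundL hne)
        exact ⟨⟨N', hN' ▸ hEfin⟩, (hS _).2 ⟨hN', hQ⟩, rfl⟩
    · rintro _ ⟨N', hN', rfl⟩
      exact isPolytope_basePolytope hEfin ((hS N').1 hN').1.le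
    · rw [eM, eL]
      ext x
      simp only [mem_union, mem_ofPred_eq, LinearMap.neg_apply, neg_le_neg_iff, ← and_or_left]
      exact ⟨fun hx => ⟨hx, le_total _ _⟩, fun hx => hx.1⟩
  -- `U` and `W` lie strictly on opposite sides, so the cut passes through the relative interior of
  -- `P`.
  obtain ⟨x₀, hx₀, hx₀r⟩ : ∃ x, IsCore P x ∧ l x = r := by
    obtain ⟨x, hx⟩ := exists_isCore hP basePolytope_nonempty
    exact exists_isCore_apply_eq hP hx (IsBase.indicatorVec_mem hU') hlu
      (IsBase.indicatorVec_mem hW') hlw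
  have hx₀N : x₀ ∈ basePolytope E N.1 := by rw [eN]; exact ⟨hx₀.1, hx₀r⟩
  -- The pieces and the slice all contain the core point `x₀`; conversely, a face of a piece
  -- containing a core point of `P` is that piece or the slice.
  have hfilter : ∀ N', N' ∈ ({M, L, N} : Finset FinMatroid) ↔
      N' ∈ S ∧ ¬ basePolytope E N'.1 ⊆ intrinsicFrontier ℝ P := by
    intro N'
    simp only [Finset.mem_insert, Finset.mem_singleton]
    constructor
    · rintro (rfl | rfl | rfl)
      · exact ⟨(hS _).2 ⟨h.ground, Or.inl fMM⟩,
          (not_subset_intrinsicFrontier_iff hP sM).2 ⟨x₀, fM.2.subset hx₀N, hx₀⟩⟩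
      · exact ⟨(hS _).2 ⟨h.groundL, Or.inr fLL⟩,
          (not_subset_intrinsicFrontier_iff hP sL).2 ⟨x₀, fL.2.subset hx₀N, hx₀⟩⟩
      · exact ⟨(hS _).2 ⟨h.groundN, Or.inl fM⟩,
          (not_subset_intrinsicFrontier_iff hP (fM.2.subset.trans sM)).2 ⟨x₀, hx₀N, hx₀⟩⟩
    · rintro ⟨hN'S, hN'⟩
      obtain ⟨hN'E, hN'F⟩ := (hS N').1 hN'S
      have heq : ∀ K : FinMatroid, K.1.E = E → basePolytope E N'.1 = basePolytope E K.1 → N' = K :=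
        fun K hK e => Subtype.ext (eq_of_basePolytope_eq hN'E hK e)
      rcases hN'F with hF | hF
      · obtain ⟨x, hxN', hx⟩ := (not_subset_intrinsicFrontier_iff hP (hF.2.subset.trans sM)).1 hN'
        rw [eM] at hF
        rcases hF.eq_or_eq_of_isCore hP hxN' hx with e | e
        · exact Or.inl (heq M h.ground (e.trans eM.symm))
        · exact Or.inr (Or.inr (heq N h.groundN (e.trans eN.symm)))
      · obtain ⟨x, hxN', hx⟩ := (not_subset_intrinsicFrontier_iff hP (hF.2.subset.trans sL)).1 hN'
        rw [eL] at hF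
        rcases hF.eq_or_eq_of_isCore hP hxN' hx with e | e
        · exact Or.inr (Or.inl (heq L h.groundL (e.trans eL.symm)))
        · exact Or.inr (Or.inr (heq N h.groundN (e.trans eN'.symm)))
  have dM : dim (basePolytope E M.1) = dim P := by
    rw [eM]; exact dim_setOf_le hP (IsBase.indicatorVec_mem hU') hlu
  have dL : dim (basePolytope E L.1) = dim P := by
    rw [eL]
    exact dim_setOf_le hP (IsBase.indicatorVec_mem hW') (by simpa using hlw)
  have dN : dim P = dim (basePolytope E N.1) + 1 := by
    rw [eN]; exact dim_setOf_eq hP hx₀ hx₀r (IsBase.indicatorVec_mem hU') hlu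
  have hUN : ¬ N.1.IsBase U := fun hb => hUr.ne ((h.isBaseN_iff U).1 hb).2.2
  have hUL : ¬ L.1.IsBase U := fun hb => hUr.not_ge ((h.isBaseL_iff U).1 hb).2.2
  have hWN : ¬ N.1.IsBase W := fun hb => hWr.ne' ((h.isBaseN_iff W).1 hb).2.2
  -- Distinctness is needed for the sum over `{M, L, N}` to have three terms.
  have hML : M ≠ L := by rintro rfl; exact hUL hU
  have hMN : M ≠ N := by rintro rfl; exact hUN hU
  have hLN : L ≠ N := by rintro rfl; exact hWN hWL
  rw [hval E M' S h.ground' (fun N' hN' => ((hS N').1 hN').1) hsub,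
    Finset.sum_congr (s₂ := {M, L, N}) (Finset.ext fun N' => by
      rw [Finset.mem_filter]; exact (hfilter N').symm) fun _ _ => rfl,
    Finset.sum_insert (by simp [hML, hMN]), Finset.sum_insert (by simp [hLN]),
    Finset.sum_singleton]
  have e1 : dim P - dim (basePolytope E N.1) = 1 := by omega
  change (-1 : ℤ) ^ (dim P - dim (basePolytope E M.1)) • f M +
    ((-1 : ℤ) ^ (dim P - dim (basePolytope E L.1)) • f L +
      (-1 : ℤ) ^ (dim P - dim (basePolytope E N.1)) • f N) = _
  rw [e1, dM, dL]
  simp only [Nat.sub_self, pow_zero, one_smul, pow_one, neg_smul]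
  abel

/-- If one side of the cut is degenerate, the identity is trivial: either `M = N` and `M' = L`, or
`L = N` and `M' = M`. -/
lemma IsValuation.eq_add_sub (hval : IsValuation f)
    (h : IsRelaxationCut E A k r M.1 M'.1 L.1 N.1) : f M' = f M + f L - f N := by
  by_cases hu : ∃ B, M.1.IsBase B ∧ (B ∩ A).ncard < r
  swap
  · push Not at hu
    have hMN : M = N := Subtype.ext (Matroid.ext_isBase (h.ground.trans h.groundN.symm) fun B _ =>
      ⟨fun hB => (h.isBaseN_iff B).2 ⟨h.ground ▸ hB.subset_ground, h.card B hB,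
        le_antisymm (h.le B hB) (hu B hB)⟩, h.isBase_of B⟩)
    have hLM' : M' = L := Subtype.ext (Matroid.ext_isBase (h.ground'.trans h.groundL.symm)
      fun B _ => by
        rw [h.isBase_iff, h.isBaseL_iff, hMN, h.isBaseN_iff, ← and_or_left, ← and_or_left]
        have : (B ∩ A).ncard = r ∨ r + 1 ≤ (B ∩ A).ncard ↔ r ≤ (B ∩ A).ncard := by omega
        rw [this])
    rw [hMN, hLM']
    abel
  by_cases hv : ∃ B ⊆ E, B.ncard = k ∧ r < (B ∩ A).ncard
  · exact hval.eq_add_sub_of_exists h hu hv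
  · push Not at hv
    have hLN : L = N := Subtype.ext (Matroid.ext_isBase (h.groundL.trans h.groundN.symm) fun B _ => by
      rw [h.isBaseL_iff, h.isBaseN_iff]
      exact ⟨fun hB => ⟨hB.1, hB.2.1, le_antisymm (hv B hB.1 hB.2.1) hB.2.2⟩,
        fun hB => ⟨hB.1, hB.2.1, hB.2.2.ge⟩⟩)
    have hMM' : M' = M := Subtype.ext (Matroid.ext_isBase (h.ground'.trans h.ground.symm) fun B _ => by
      rw [h.isBase_iff, or_iff_left]
      rintro ⟨h1, h2, h3⟩
      exact absurd (hv B h1 h2) (by omega))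
    rw [hLN, hMM', add_sub_cancel_right]

end valuation

/-! ### Isomorphisms from counting conditions -/

section iso
variable {α β : Type*} {M : Matroid α} {N : Matroid β}

lemma Iso.of_bijOn {φ : α → β} (hφ : BijOn φ M.E N.E)
    (h : ∀ B ⊆ M.E, M.IsBase B ↔ N.IsBase (φ '' B)) : Iso M N := by
  refine ⟨hφ.equiv φ, fun B => ?_⟩
  have e : Subtype.val '' (hφ.equiv φ '' B) = φ '' (Subtype.val '' B) := by
    rw [image_image, image_image]
    rfl
  rw [e]
  exact h _ (by rintro _ ⟨x, -, rfl⟩; exact x.2)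

lemma exists_bijOn_bijOn [Nonempty β] {E A : Set α} {E' A' : Set β} (hE : E.Finite)
    (hE' : E'.Finite) (hA : A ⊆ E) (hA' : A' ⊆ E') (hc : E.ncard = E'.ncard)
    (hcA : A.ncard = A'.ncard) : ∃ φ : α → β, BijOn φ E E' ∧ BijOn φ A A' := by
  classical
  have hAf := hE.subset hA
  have hAf' := hE'.subset hA'
  obtain ⟨f, hf⟩ := hAf.exists_bijOn_of_encard_eq (t := A')
    (by rw [← hAf.cast_ncard_eq, ← hAf'.cast_ncard_eq, hcA])
  have hd : (E \ A).ncard = (E' \ A').ncard := by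
    rw [ncard_sdiff hA hAf, ncard_sdiff hA' hAf', hc, hcA]
  obtain ⟨g, hg⟩ := (hE.subset (sdiff_subset (s := E) (t := A))).exists_bijOn_of_encard_eq
    (t := E' \ A') (by
      rw [← (hE.subset sdiff_subset).cast_ncard_eq, ← (hE'.subset sdiff_subset).cast_ncard_eq, hd])
  have h1 : BijOn (A.piecewise f g) A A' :=
    hf.congr fun x hx => (piecewise_eq_of_mem A f g hx).symm
  have h2 : BijOn (A.piecewise f g) (E \ A) (E' \ A') :=
    hg.congr fun x hx => (piecewise_eq_of_notMem A f g hx.2).symm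
  refine ⟨A.piecewise f g, ?_, h1⟩
  have h := h1.union h2 ?_
  · rwa [union_sdiff_cancel hA, union_sdiff_cancel hA'] at h
  · rw [injOn_union disjoint_sdiff_right]
    exact ⟨h1.injOn, h2.injOn, fun a ha b hb e => (h2.mapsTo hb).2 (e ▸ h1.mapsTo ha)⟩

/-- Two matroids whose bases are characterized in the same way by their sizes and the sizes of their
intersections with a fixed set are isomorphic. -/
lemma Iso.of_forall_isBase_iff [Nonempty β] {A : Set α} {A' : Set β} (hE : M.E.Finite)
    (hE' : N.E.Finite) (hA : A ⊆ M.E) (hA' : A' ⊆ N.E) (hc : M.E.ncard = N.E.ncard)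
    (hcA : A.ncard = A'.ncard) (p : ℕ → ℕ → Prop)
    (hM : ∀ B ⊆ M.E, M.IsBase B ↔ p B.ncard (B ∩ A).ncard)
    (hN : ∀ B ⊆ N.E, N.IsBase B ↔ p B.ncard (B ∩ A').ncard) : Iso M N := by
  obtain ⟨φ, hφ, hφA⟩ := exists_bijOn_bijOn hE hE' hA hA' hc hcA
  refine Iso.of_bijOn hφ fun B hB => ?_
  have h1 : (φ '' B).ncard = B.ncard := (hφ.injOn.mono hB).ncard_image
  have h2 : φ '' B ∩ A' = φ '' (B ∩ A) := by
    rw [hφ.injOn.image_inter hB hA, hφA.image_eq]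
  have h3 : (φ '' (B ∩ A)).ncard = (B ∩ A).ncard :=
    (hφ.injOn.mono (inter_subset_left.trans hB)).ncard_image
  rw [hM B hB, hN _ (hφ.mapsTo.image_subset.trans' (image_mono hB)), h1, h2, h3]

end iso

/-! ### Bases of sums of two uniform matroids and of their relaxations -/

section uniform
variable {α : Type*} {X Y B : Set α} {a b : ℕ}

lemma uniformOn_isBase_iff (hX : X.Finite) (ha : a ≤ X.ncard) :
    (uniformOn X hX a).IsBase B ↔ B ⊆ X ∧ B.ncard = a := by
  have : (uniformOn X hX a).IsBase B ↔ B ⊆ X ∧ B.encard = (min a X.ncard : ℕ) := Iff.rfl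
  rw [this, min_eq_left ha]
  refine and_congr_right fun hB => ?_
  rw [← (hX.subset hB).cast_ncard_eq]
  norm_cast

lemma disjointSum_uniformOn_isBase_iff (hX : X.Finite) (hY : Y.Finite)
    (hd : Disjoint (uniformOn X hX a).E (uniformOn Y hY b).E)
    (ha : a ≤ X.ncard) (hb : b ≤ Y.ncard) :
    ((uniformOn X hX a).disjointSum (uniformOn Y hY b) hd).IsBase B ↔
      B ⊆ X ∪ Y ∧ B.ncard = a + b ∧ (B ∩ Y).ncard = b := by
  have hd' : Disjoint X Y := hd
  have hXE : (uniformOn X hX a).E = X := rfl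
  have hYE : (uniformOn Y hY b).E = Y := rfl
  rw [Matroid.disjointSum_isBase_iff, hXE, hYE, uniformOn_isBase_iff hX ha,
    uniformOn_isBase_iff hY hb]
  have hsum : B ⊆ X ∪ Y → B.ncard = (B ∩ X).ncard + (B ∩ Y).ncard := by
    intro hB
    rw [← ncard_union_eq (hd'.mono inter_subset_right inter_subset_right)
      (hX.subset inter_subset_right) (hY.subset inter_subset_right), ← inter_union_distrib_left,
      inter_eq_self_of_subset_left hB]
  constructor
  · rintro ⟨⟨-, h1⟩, ⟨-, h2⟩, h3⟩
    exact ⟨h3, by rw [hsum h3, h1, h2], h2⟩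
  · rintro ⟨h3, h1, h2⟩
    have := hsum h3
    exact ⟨⟨inter_subset_right, by omega⟩, ⟨inter_subset_right, h2⟩, h3⟩

lemma relaxation_isBase_iff {M : Matroid α} [M.Finite] {A : Set α} (hA : IsStressed M A) :
    (relaxation M A hA).IsBase B ↔ M.IsBase B ∨ B ∈ cusp M A := Iff.rfl

lemma eRank_disjointSum_uniformOn (hX : X.Finite) (hY : Y.Finite)
    (hd : Disjoint (uniformOn X hX a).E (uniformOn Y hY b).E)
    (ha : a ≤ X.ncard) (hb : b ≤ Y.ncard) :
    ((uniformOn X hX a).disjointSum (uniformOn Y hY b) hd).eRank = (a + b : ℕ) := by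
  obtain ⟨B, hB⟩ := ((uniformOn X hX a).disjointSum (uniformOn Y hY b) hd).exists_isBase
  obtain ⟨h1, h2, -⟩ := (disjointSum_uniformOn_isBase_iff hX hY hd ha hb).1 hB
  rw [← hB.encard_eq_eRank, ← ((hX.union hY).subset h1).cast_ncard_eq, h2]

lemma relaxation_disjointSum_uniformOn_isBase_iff (hX : X.Finite) (hY : Y.Finite)
    (hd : Disjoint (uniformOn X hX a).E (uniformOn Y hY b).E)
    (ha : a ≤ X.ncard) (hb : b ≤ Y.ncard)
    [hf : ((uniformOn X hX a).disjointSum (uniformOn Y hY b) hd).Finite]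
    (hs : IsStressed ((uniformOn X hX a).disjointSum (uniformOn Y hY b) hd) Y) :
    (relaxation _ Y hs).IsBase B ↔ B ⊆ X ∪ Y ∧ B.ncard = a + b ∧ b ≤ (B ∩ Y).ncard := by
  have hbase := fun B => disjointSum_uniformOn_isBase_iff (B := B) hX hY hd ha hb
  have hk := eRank_disjointSum_uniformOn hX hY hd ha hb
  obtain ⟨B₀, hB₀⟩ := ((uniformOn X hX a).disjointSum (uniformOn Y hY b) hd).exists_isBase
  have hr : ((uniformOn X hX a).disjointSum (uniformOn Y hY b) hd).eRk Y = b :=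
    eRk_eq_of_forall_isBase hs.1 ⟨B₀, hB₀, ((hbase B₀).1 hB₀).2.2⟩
      fun B hB => ((hbase B).1 hB).2.2.le
  rw [relaxation_isBase_iff, hbase, mem_cusp_iff hk hr, Matroid.disjointSum_ground_eq]
  have hXE : (uniformOn X hX a).E = X := rfl
  have hYE : (uniformOn Y hY b).E = Y := rfl
  rw [hXE, hYE, ← and_or_left, ← and_or_left]
  have : (B ∩ Y).ncard = b ∨ b + 1 ≤ (B ∩ Y).ncard ↔ b ≤ (B ∩ Y).ncard := by omega
  rw [this]

end uniform

/-! ### The standard models on initial intervals -/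

section interval

lemma ncard_interval (a b : ℕ) : (interval a b).ncard = b - a := by
  have h : (fun i : ℕ+ => (i : ℕ)) '' interval a b = Finset.Ioc a b := by
    ext x
    simp only [interval, mem_image, mem_ofPred_eq, Finset.coe_Ioc, mem_Ioc]
    constructor
    · rintro ⟨i, hi, rfl⟩; exact hi
    · intro hx
      exact ⟨⟨x, by omega⟩, hx, rfl⟩
  rw [← ncard_image_of_injective _ PNat.coe_injective, h, ncard_coe_finset, Nat.card_Ioc]

lemma interval_union_interval {a b c : ℕ} (h₁ : a ≤ b) (h₂ : b ≤ c) :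
    interval a b ∪ interval b c = interval a c := by
  ext i
  simp only [interval, mem_union, mem_ofPred_eq]
  omega

variable {r k h n : ℕ} {B : Set ℕ+}

lemma uniformSum_ground : (uniformSum r k h n).1.E = interval 0 n := by
  have : (uniformSum r k h n).1.E = interval 0 (n - h) ∪ interval (n - h) n :=
    Matroid.disjointSum_ground_eq
  rw [this, interval_union_interval (Nat.zero_le _) (Nat.sub_le _ _)]

lemma uniformSum_isBase_iff (hh : h ≤ n) (hrh : r ≤ h) (hrk : r ≤ k) (hkr : k - r ≤ n - h) :
    (uniformSum r k h n).1.IsBase B ↔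
      B ⊆ interval 0 n ∧ B.ncard = k ∧ (B ∩ interval (n - h) n).ncard = r := by
  have := disjointSum_uniformOn_isBase_iff (a := k - r) (b := r) (B := B)
    (interval_finite 0 (n - h)) (interval_finite (n - h) n) (interval_disjoint _ _ _)
    (by rw [ncard_interval]; omega) (by rw [ncard_interval]; omega)
  rw [interval_union_interval (Nat.zero_le _) (Nat.sub_le _ _), Nat.sub_add_cancel hrk] at this
  exact this

lemma cuspidal_isBase_iff (hh : h ≤ n) (hrh : r ≤ h) (hrk : r ≤ k) (hkr : k - r ≤ n - h) :
    (cuspidal r k h n).1.IsBase B ↔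
      B ⊆ interval 0 n ∧ B.ncard = k ∧ r ≤ (B ∩ interval (n - h) n).ncard := by
  have : (uniformSum r k h n).1.Finite := ⟨(uniformSum r k h n).2⟩
  have := relaxation_disjointSum_uniformOn_isBase_iff (a := k - r) (b := r) (B := B)
    (interval_finite 0 (n - h)) (interval_finite (n - h) n) (interval_disjoint _ _ _)
    (by rw [ncard_interval]; omega) (by rw [ncard_interval]; omega) (hf := this)
    (isStressed_uniformSum r k h n)
  rw [interval_union_interval (Nat.zero_le _) (Nat.sub_le _ _), Nat.sub_add_cancel hrk] at this
  exact this

lemma cuspidal_ground : (cuspidal r k h n).1.E = interval 0 n :=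
  uniformSum_ground (r := r) (k := k)

end interval

/-! ### Relaxation and valuative invariants -/

section relaxation
variable {G : Type*} [AddCommGroup G] {f : FinMatroid → G} {A : Set ℕ+} {k n r h : ℕ}

/-- Relaxing a stressed subset changes a valuative invariant by a term that depends only on the rank
and size of the subset. -/
lemma IsValuation.relaxation_eq (hinv : IsInvariant f) (hval : IsValuation f) (M M' : FinMatroid)
    [M.1.Finite] (hE : M'.1.E = M.1.E) (hA : IsStressed M.1 A) (hk : M.1.eRank = k)
    (hn : M.1.E.ncard = n) (hr : M.1.eRk A = r) (hh : A.ncard = h)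
    (hM' : ∀ B, M'.1.IsBase B ↔ M.1.IsBase B ∨ B ∈ cusp M.1 A) :
    f M' = f M + (f (cuspidal r k h n) - f (uniformSum r k h n)) := by
  set E := M.1.E
  have hEf : E.Finite := M.2
  have hAf : A.Finite := hEf.subset hA.1
  have hXf : (E \ A).Finite := hEf.subset sdiff_subset
  obtain ⟨B₀, hB₀, hB₀r⟩ := exists_isBase_ncard_inter_eq hA.1 hr
  have hB₀k := IsBase.ncard_eq hk hB₀
  have hB₀f := hEf.subset hB₀.subset_ground
  have hs := ncard_inter_add_ncard_sdiff_eq_ncard B₀ A hB₀f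
  have hX : (E \ A).ncard = n - h := by rw [ncard_sdiff hA.1 hAf, hn, hh]
  have hhn : h ≤ n := by rw [← hh, ← hn]; exact ncard_le_ncard hA.1 hEf
  -- These bounds, witnessed by `B₀`, make the minimum in `uniformOn` inactive and the natural
  -- subtractions exact.
  have hrh : r ≤ h := by rw [← hB₀r, ← hh]; exact ncard_le_ncard inter_subset_right hAf
  have hrk : r ≤ k := by omega
  have hkr : k - r ≤ n - h := by
    have : (B₀ \ A).ncard ≤ (E \ A).ncard :=
      ncard_le_ncard (sdiff_subset_sdiff_left hB₀.subset_ground) hXf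
    omega
  have hd : Disjoint (E \ A) A := disjoint_sdiff_left
  have hu : E \ A ∪ A = E := sdiff_union_of_subset hA.1
  -- `N` and its relaxation `L` are copies on `E` of the two standard matroids, with `A` in the role
  -- of the last `h` elements.
  let N : FinMatroid := ⟨(uniformOn (E \ A) hXf (k - r)).disjointSum (uniformOn A hAf r) hd,
    finite_disjointSum _ hXf hAf⟩
  have hNE : N.1.E = E := Matroid.disjointSum_ground_eq.trans hu
  have hNf : N.1.Finite := ⟨N.2⟩
  have hNs : IsStressed N.1 A := isStressed_disjointSum hd ⟨_, fun _ => Iff.rfl⟩ ⟨_, fun _ => Iff.rfl⟩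
  let L : FinMatroid := ⟨relaxation N.1 A hNs, N.2⟩
  have hN : ∀ B, N.1.IsBase B ↔ B ⊆ E ∧ B.ncard = k ∧ (B ∩ A).ncard = r := by
    intro B
    have := disjointSum_uniformOn_isBase_iff (a := k - r) (b := r) (B := B) hXf hAf hd
      (by omega) (by omega)
    rw [hu, Nat.sub_add_cancel hrk] at this
    exact this
  have hL : ∀ B, L.1.IsBase B ↔ B ⊆ E ∧ B.ncard = k ∧ r ≤ (B ∩ A).ncard := by
    intro B
    have := relaxation_disjointSum_uniformOn_isBase_iff (a := k - r) (b := r) (B := B) hXf hAf hd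
      (by omega) (by omega) (hf := hNf) hNs
    rw [hu, Nat.sub_add_cancel hrk] at this
    exact this
  have hcut : IsRelaxationCut E A k r M.1 M'.1 L.1 N.1 :=
    { ground := rfl
      ground' := hE
      groundL := hNE
      groundN := hNE
      card := fun B hB => IsBase.ncard_eq hk hB
      le := fun B hB => IsBase.ncard_inter_le hr hB
      isBase_iff := fun B => by rw [hM', mem_cusp_iff hk hr]
      isBaseL_iff := hL
      isBaseN_iff := hN
      isBase_of := fun B hB => by
        obtain ⟨h1, h2, h3⟩ := (hN B).1 hB
        exact hA.isBase hk hr h1 h2 h3 }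
  have hI : (interval (n - h) n).ncard = h := by rw [ncard_interval]; omega
  have hIs : interval (n - h) n ⊆ interval 0 n := fun i hi => ⟨by have := hi.1; omega, hi.2⟩
  have eN : f N = f (uniformSum r k h n) := by
    refine hinv _ _ (Iso.of_forall_isBase_iff N.2 (uniformSum r k h n).2 (A := A)
      (A' := interval (n - h) n) (hNE ▸ hA.1) (by rwa [uniformSum_ground])
      (by rw [hNE, uniformSum_ground, ncard_interval, hn, Nat.sub_zero]) (by rw [hh, hI])
      (fun s t => s = k ∧ t = r) (fun B hB => ?_) fun B hB => ?_)
    · rw [hN, and_iff_right (hNE ▸ hB)]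
    · rw [uniformSum_isBase_iff hhn hrh hrk hkr, and_iff_right (uniformSum_ground ▸ hB)]
  have eL : f L = f (cuspidal r k h n) := by
    have hLE : L.1.E = E := hNE
    refine hinv _ _ (Iso.of_forall_isBase_iff L.2 (cuspidal r k h n).2 (A := A)
      (A' := interval (n - h) n) (hLE ▸ hA.1) (by rwa [cuspidal_ground])
      (by rw [hLE, cuspidal_ground, ncard_interval, hn, Nat.sub_zero]) (by rw [hh, hI])
      (fun s t => s = k ∧ r ≤ t) (fun B hB => ?_) fun B hB => ?_)
    · rw [hL, and_iff_right (hLE ▸ hB)]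
    · rw [cuspidal_isBase_iff hhn hrh hrk hkr, and_iff_right (cuspidal_ground ▸ hB)]
  rw [hval.eq_add_sub hcut, eN, eL, add_sub_assoc]

/-- The effect on a valuative invariant of relaxing several stressed subsets simultaneously. -/
lemma IsValuation.exists_relaxation_eq (hinv : IsInvariant f) (hval : IsValuation f)
    (M : FinMatroid) (hk : M.1.eRank = k) (hn : M.1.E.ncard = n) (T : Finset (Set ℕ+))
    (hT : ∀ A ∈ T, IsStressed M.1 A) :
    ∃ M' : FinMatroid, M'.1.E = M.1.E ∧
      (∀ B, M'.1.IsBase B ↔ M.1.IsBase B ∨ ∃ A ∈ T, B ∈ cusp M.1 A) ∧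
      f M' = f M + ∑ A ∈ T, (f (cuspidal (M.1.eRk A).toNat k A.ncard n) -
        f (uniformSum (M.1.eRk A).toNat k A.ncard n)) := by
  classical
  have : M.1.Finite := ⟨M.2⟩
  induction T using Finset.induction_on with
  | empty => exact ⟨M, rfl, by simp, by simp⟩
  | insert A T hAT ih =>
    obtain ⟨M₁, hE, hB, hf⟩ := ih fun A hA => hT A (Finset.mem_insert_of_mem hA)
    have hAs := hT A (Finset.mem_insert_self A T)
    have : M₁.1.Finite := ⟨M₁.2⟩
    obtain ⟨r, hr⟩ := exists_eRk_eq M.1 A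
    have hcard : ∀ B, M₁.1.IsBase B → B.ncard = k := by
      intro B h
      rcases (hB B).1 h with h | ⟨A', -, h⟩
      · exact IsBase.ncard_eq hk h
      · rw [← encard_eq_iff_ncard_of_subset h.1, h.2.1, hk]
    have hk₁ : M₁.1.eRank = k := by
      obtain ⟨B, h⟩ := M₁.1.exists_isBase
      rw [← h.encard_eq_eRank, encard_eq_iff_ncard_of_subset h.subset_ground, hcard B h]
    have hA₁ : A ⊆ M₁.1.E := hE ▸ hAs.1
    -- The bases added so far lie in cusps of other stressed subsets, hence outside the cusp of `A`,
    -- so they meet `A` in at most `r` elements.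
    have hr₁ : M₁.1.eRk A = r := by
      obtain ⟨B₀, hB₀, hB₀r⟩ := exists_isBase_ncard_inter_eq hAs.1 hr
      refine eRk_eq_of_forall_isBase hA₁ ⟨B₀, (hB B₀).2 (Or.inl hB₀), hB₀r⟩ fun B h => ?_
      rcases (hB B).1 h with h | ⟨A', hA', h⟩
      · exact IsBase.ncard_inter_le hr h
      · by_contra! hlt
        refine disjoint_left.1 (disjoint_cusp hAs (hT A' (Finset.mem_insert_of_mem hA'))
          (by rintro rfl; exact hAT hA')) ((mem_cusp_iff hk hr).2 ⟨h.1, ?_, hlt⟩) h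
        rw [← encard_eq_iff_ncard_of_subset h.1, h.2.1, hk]
    -- Bases are only added and rank and size of `A` persist, so the `k`-sets meeting `A` in `r`
    -- elements are still bases.
    have hs₁ : IsStressed M₁.1 A := isStressed_of_forall_isBase hA₁ hk₁ hr₁ fun S hS h1 h2 =>
      (hB S).2 (Or.inl (hAs.isBase hk hr (hE ▸ hS) h1 h2))
    have hcusp : cusp M₁.1 A = cusp M.1 A := by
      ext S
      rw [mem_cusp_iff hk₁ hr₁, mem_cusp_iff hk hr, hE]
    let M' : FinMatroid := ⟨relaxation M₁.1 A hs₁, M₁.2⟩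
    refine ⟨M', hE, fun B => ?_, ?_⟩
    · have : M'.1.IsBase B ↔ M₁.1.IsBase B ∨ B ∈ cusp M₁.1 A := Iff.rfl
      rw [this, hB, hcusp, or_assoc, Finset.exists_mem_insert, or_comm (a := B ∈ cusp M.1 A)]
    · rw [hval.relaxation_eq hinv M₁ M' rfl hs₁ hk₁ (by rw [hE, hn]) hr₁ rfl fun B => Iff.rfl, hf,
        Finset.sum_insert hAT, hr, ENat.toNat_natCast]
      abel

end relaxation

/-! ### Connectivity, flacets and non-bases -/

section connectivity
variable {α : Type*} {M : Matroid α} {A X Y S F : Set α} {k : ℕ}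

lemma eRank_disjointSum (M N : Matroid α) (h : Disjoint M.E N.E) :
    (M.disjointSum N h).eRank = M.eRank + N.eRank := by
  obtain ⟨B, hB⟩ := (M.disjointSum N h).exists_isBase
  have hB' := hB
  rw [Matroid.disjointSum_isBase_iff] at hB'
  obtain ⟨h1, h2, h3⟩ := hB'
  rw [← hB.encard_eq_eRank, ← h1.encard_eq_eRank, ← h2.encard_eq_eRank,
    ← encard_union_eq (h.mono inter_subset_right inter_subset_right), ← inter_union_distrib_left,
    inter_eq_self_of_subset_left h3]

lemma restrict_disjointSum_left (M N : Matroid α) (h : Disjoint M.E N.E) :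
    (M.disjointSum N h).restrict M.E = M := by
  refine Matroid.ext_indep rfl fun I hI => ?_
  have hI : I ⊆ M.E := hI
  simp [Matroid.restrict_indep_iff, Matroid.disjointSum_indep_iff, (h.mono_left hI).inter_eq,
    inter_eq_self_of_subset_left hI, hI, hI.trans subset_union_left]

lemma eRk_disjointSum_left (M N : Matroid α) (h : Disjoint M.E N.E) :
    (M.disjointSum N h).eRk M.E = M.eRank := by
  rw [← Matroid.eRank_restrict, restrict_disjointSum_left]

lemma eRk_disjointSum_right (M N : Matroid α) (h : Disjoint M.E N.E) :
    (M.disjointSum N h).eRk N.E = N.eRank := by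
  rw [Matroid.disjointSum_comm, eRk_disjointSum_left]

/-- A matroid is the direct sum of its restrictions to complementary sets whose ranks add up to
at most the rank of the matroid. -/
lemma eq_disjointSum_of_eRk_add_le [M.Finite]
    (hd : Disjoint (M.restrict X).E (M.restrict Y).E) (hu : X ∪ Y = M.E) (h : M.eRk X + M.eRk Y ≤ M.eRank) :
    M = (M.restrict X).disjointSum (M.restrict Y) hd := by
  refine Matroid.ext_indep (by simp [hu]) fun I hI => ?_
  rw [Matroid.disjointSum_indep_iff]
  simp only [Matroid.restrict_indep_iff, Matroid.restrict_ground_eq, inter_subset_right, and_true,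
    hu]
  refine ⟨fun h => ⟨h.subset inter_subset_left, h.subset inter_subset_left, h.subset_ground⟩, ?_⟩
  rintro ⟨h1, h2, -⟩
  have hd : Disjoint X Y := hd
  have hX : X ⊆ M.E := hu ▸ subset_union_left
  have hY : Y ⊆ M.E := hu ▸ subset_union_right
  -- Extend the two parts of `I` to bases of `X` and `Y`. Their union spans `M` and by `h` has no
  -- more elements than its rank, so it is independent.
  obtain ⟨J, hJ, hJI⟩ := h1.subset_isBasis_of_subset inter_subset_right hX
  obtain ⟨K, hK, hKI⟩ := h2.subset_isBasis_of_subset inter_subset_right hY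
  have hsp : M.eRank ≤ M.eRk (J ∪ K) := by
    rw [hJ.eRk_eq_eRk_union, union_comm, hK.eRk_eq_eRk_union, union_comm, hu, M.eRk_ground]
  have hJKE : J ∪ K ⊆ M.E := union_subset (hJ.subset.trans hX) (hK.subset.trans hY)
  have hind : M.Indep (J ∪ K) := by
    rw [Matroid.indep_iff_eRk_eq_encard_of_finite (M.set_finite _ hJKE)]
    refine le_antisymm (M.eRk_le_encard _) ?_
    rw [encard_union_eq (hd.mono hJ.subset hK.subset), hJ.encard_eq_eRk, hK.encard_eq_eRk]
    exact h.trans hsp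
  refine hind.subset fun x hx => ?_
  rcases (hu ▸ hI hx : x ∈ X ∪ Y) with h | h
  · exact Or.inl (hJI ⟨hx, h⟩)
  · exact Or.inr (hKI ⟨hx, h⟩)

/-- This replaces direct sum decompositions by rank inequalities, so that connectivity can be
combined with submodularity. -/
lemma isConnected_iff_forall_eRank_lt [M.Finite] :
    IsConnected M ↔ ∀ X Y, Disjoint X Y → X.Nonempty → Y.Nonempty → X ∪ Y = M.E →
      M.eRank < M.eRk X + M.eRk Y := by
  constructor
  · intro h X Y hd hX hY hu
    by_contra! hle
    exact h ⟨M.restrict X, M.restrict Y, hd, hX, hY, eq_disjointSum_of_eRk_add_le hd hu hle⟩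
  · rintro h ⟨M₁, M₂, hd, h₁, h₂, rfl⟩
    have := h M₁.E M₂.E hd h₁ h₂ Matroid.disjointSum_ground_eq.symm
    rw [eRk_disjointSum_left, eRk_disjointSum_right, eRank_disjointSum] at this
    exact this.false

/-- Extend a basis `I` of `A` to a basis `K` of `X ∪ A`; then `K \ I` is a basis of `X` in the
contraction. -/
lemma eRk_contract_add_eRk (hA : A ⊆ M.E) (hX : X ⊆ M.E \ A) :
    (M.contract A).eRk X + M.eRk A = M.eRk (X ∪ A) := by
  obtain ⟨I, hI⟩ := M.exists_isBasis A hA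
  obtain ⟨K, hK, hIK⟩ := hI.indep.subset_isBasis_of_subset (hI.subset.trans subset_union_right)
    (union_subset (hX.trans sdiff_subset) hA)
  have hKA : Disjoint A (K \ I) := disjoint_left.2 fun x hxA hx =>
    hx.2 (hI.mem_of_insert_indep hxA (hK.indep.subset (insert_subset hx.1 hIK)))
  have hKX : K \ I ⊆ X := fun x hx => (hK.subset hx.1).resolve_right fun h =>
    disjoint_left.1 hKA h hx
  have hb : (M.contract A).IsBasis (K \ I) X := by
    have hind : (M.contract A).Indep (K \ I) := by
      rw [hI.contract_indep_iff, sdiff_union_of_subset hIK]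
      exact ⟨hK.indep, hKA⟩
    refine hind.isBasis_of_forall_insert hKX fun e he => ?_
    rw [Matroid.dep_iff]
    refine ⟨fun hi => ?_, insert_subset (hX he.1) hind.subset_ground⟩
    rw [hI.contract_indep_iff, insert_union, sdiff_union_of_subset hIK] at hi
    exact he.2 ⟨hK.mem_of_insert_indep (Or.inl he.1) hi.1, fun h => (hX he.1).2 (hI.subset h)⟩
  rw [← hb.encard_eq_eRk, ← hI.encard_eq_eRk, ← hK.encard_eq_eRk,
    encard_sdiff_add_encard_of_subset hIK]

/-- In a connected matroid every dependent set of the size of a basis lies in the cusp of a split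
flacet. -/
theorem exists_isSplitFlacet_mem_cusp [M.Finite] (hM : IsConnected M) (hSE : S ⊆ M.E)
    (hS : S.encard = M.eRank) (hSb : ¬ M.IsBase S) : ∃ F, IsSplitFlacet M F ∧ S ∈ cusp M F := by
  -- With a rank function valued in the natural numbers, everything below becomes linear arithmetic
  -- on submodularity and connectivity inequalities.
  choose ρ hρ using exists_eRk_eq M
  obtain ⟨k, hk⟩ := exists_eRank_eq M
  have hSf := M.set_finite S hSE
  have hSk : S.ncard = k := by rw [← encard_eq_iff_ncard_of_subset hSE, hS, hk]
  have hρE : ρ M.E = k := by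
    have := M.eRk_ground
    rw [hρ, hk] at this
    exact_mod_cast this
  have hmono : ∀ X Y, X ⊆ Y → ρ X ≤ ρ Y := fun X Y h => by
    have := M.eRk_mono h
    rw [hρ, hρ] at this
    exact_mod_cast this
  have hsub : ∀ X Y, ρ (X ∩ Y) + ρ (X ∪ Y) ≤ ρ X + ρ Y := fun X Y => by
    have := M.eRk_inter_add_eRk_union_le X Y
    simp only [hρ] at this
    exact_mod_cast this
  have hρk : ∀ X, ρ X ≤ k := fun X => by
    have := M.eRk_le_eRank X
    rw [hρ, hk] at this
    exact_mod_cast this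
  have hMc : ∀ X Y, Disjoint X Y → X.Nonempty → Y.Nonempty → X ∪ Y = M.E → k < ρ X + ρ Y := by
    intro X Y hd hX hY hu
    have := isConnected_iff_forall_eRank_lt.1 hM X Y hd hX hY hu
    rw [hk, hρ, hρ] at this
    exact_mod_cast this
  have hres : ∀ A ⊆ M.E, (IsConnected (M.restrict A) ↔ ∀ X Y, Disjoint X Y → X.Nonempty →
      Y.Nonempty → X ∪ Y = A → ρ A < ρ X + ρ Y) := by
    intro A hA
    have : (M.restrict A).Finite := ⟨M.set_finite A hA⟩
    rw [isConnected_iff_forall_eRank_lt]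
    refine forall₂_congr fun X Y => forall₃_congr fun _ _ _ => ?_
    refine forall_congr' fun hu => ?_
    have hu : X ∪ Y = A := hu
    rw [Matroid.eRank_restrict, M.restrict_eRk_eq (hu ▸ subset_union_left),
      M.restrict_eRk_eq (hu ▸ subset_union_right), hρ, hρ, hρ]
    norm_cast
  have hcon : ∀ A ⊆ M.E, (IsConnected (M.contract A) ↔ ∀ X Y, Disjoint X Y → X.Nonempty →
      Y.Nonempty → X ∪ Y = M.E \ A → k + ρ A < ρ (X ∪ A) + ρ (Y ∪ A)) := by
    intro A hA
    have hfin : (M.contract A).Finite := ⟨M.set_finite _ sdiff_subset⟩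
    rw [isConnected_iff_forall_eRank_lt]
    refine forall₂_congr fun X Y => forall₃_congr fun _ _ _ => ?_
    refine forall_congr' fun hu => ?_
    have hu : X ∪ Y = M.E \ A := hu
    obtain ⟨x, hx⟩ := exists_eRk_eq (M.contract A) X
    obtain ⟨y, hy⟩ := exists_eRk_eq (M.contract A) Y
    obtain ⟨z, hz⟩ := exists_eRk_eq (M.contract A) (M.E \ A)
    have h1 := eRk_contract_add_eRk hA (hu ▸ subset_union_left : X ⊆ _)
    have h2 := eRk_contract_add_eRk hA (hu ▸ subset_union_right : Y ⊆ _)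
    have h3 := eRk_contract_add_eRk hA (subset_refl (M.E \ A))
    rw [sdiff_union_of_subset hA, hz, hρ, hρ, hρE] at h3
    rw [hx, hρ, hρ] at h1
    rw [hy, hρ, hρ] at h2
    have h4 : (M.contract A).eRank = z := by rw [← hz]; exact ((M.contract A).eRk_ground).symm
    rw [h4, hx, hy]
    norm_cast at h1 h2 h3 ⊢
    omega
  have hadd : ∀ X Y, Disjoint X Y → (S ∩ (X ∪ Y)).ncard = (S ∩ X).ncard + (S ∩ Y).ncard := by
    intro X Y hd
    rw [inter_union_distrib_left, ncard_union_eq (hd.mono inter_subset_right inter_subset_right)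
      (hSf.subset inter_subset_left) (hSf.subset inter_subset_left)]
  have hSρ : ρ S < (S ∩ S).ncard := by
    rw [inter_self, hSk]
    refine lt_of_le_of_ne (hρk S) fun h => hSb ?_
    have hi : M.Indep S := by
      rw [Matroid.indep_iff_eRk_eq_encard_of_finite hSf, hρ, h, hS, hk]
    exact hi.isBase_of_eRk_ge hSf (by rw [hρ, h, hk])
  -- a minimal set with more elements in `S` than its rank is connected
  obtain ⟨A, ⟨hAE, hAρ⟩, hAmin⟩ := exists_min_image {A | A ⊆ M.E ∧ ρ A < (S ∩ A).ncard} ncard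
    (M.ground_finite.finite_subsets.subset fun A hA => hA.1) ⟨S, hSE, hSρ⟩
  have hAc : IsConnected (M.restrict A) := by
    rw [hres A hAE]
    rintro X Y hd hX hY rfl
    by_contra! hle
    have hlt : ∀ X Y : Set α, Disjoint X Y → Y.Nonempty → (X ∪ Y) ⊆ M.E →
        X.ncard < (X ∪ Y).ncard := by
      intro X Y hd hY hE
      rw [ncard_union_eq hd (M.set_finite X (subset_union_left.trans hE))
        (M.set_finite Y (subset_union_right.trans hE))]
      have := (ncard_pos (M.set_finite Y (subset_union_right.trans hE))).2 hY
      omega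
    rw [hadd X Y hd] at hAρ
    have h1 := hlt X Y hd hY hAE
    have h2 := hlt Y X hd.symm hX (by rwa [union_comm])
    rw [union_comm] at h2
    -- As `ρ X + ρ Y ≤ ρ (X ∪ Y) < |S ∩ X| + |S ∩ Y|`, one part is a smaller set with more elements
    -- in `S` than its rank.
    rcases lt_or_ge (ρ X) (S ∩ X).ncard with h | h
    · have := hAmin X ⟨subset_union_left.trans hAE, h⟩
      omega
    · have := hAmin Y ⟨subset_union_right.trans hAE, by omega⟩
      omega
  -- a maximal connected such set is a split flacet
  obtain ⟨F, ⟨hFE, hFρ, hFc⟩, hFmax⟩ := exists_max_image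
    {A | A ⊆ M.E ∧ ρ A < (S ∩ A).ncard ∧ IsConnected (M.restrict A)} ncard
    (M.ground_finite.finite_subsets.subset fun A hA => hA.1) ⟨A, hAE, hAρ, hAc⟩
  have hFne : F.Nonempty := by
    rw [nonempty_iff_ne_empty]
    rintro rfl
    simp at hFρ
  have hSF : (S ∩ F).ncard ≤ k := hSk ▸ ncard_le_ncard inter_subset_left hSf
  have hFE' : (M.E \ F).Nonempty := by
    rw [nonempty_iff_ne_empty]
    intro h
    have := hFE.antisymm (sdiff_eq_empty.1 h)
    rw [this, hρE] at hFρ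
    rw [this] at hSF
    omega
  -- If `X`, `Y` separate `M/F`, then `X ∪ F` cannot meet `S` in more elements than its rank: by
  -- maximality of `F` its restriction would split into parts `C` and `D`. A part avoiding `F` would
  -- separate `M`; if both meet `F`, they would separate `M|F`.
  have hgrow : ∀ X Y, Disjoint X Y → X.Nonempty → Y.Nonempty → X ∪ Y = M.E \ F →
      ρ (X ∪ F) + ρ (Y ∪ F) ≤ k + ρ F → (S ∩ (X ∪ F)).ncard ≤ ρ (X ∪ F) := by
    intro X Y hd hX hY hu hle
    by_contra! hlt
    have hXF : Disjoint X F := disjoint_sdiff_left.mono_left (hu ▸ subset_union_left)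
    have hYF : Disjoint Y F := disjoint_sdiff_left.mono_left (hu ▸ subset_union_right)
    have hXE : X ⊆ M.E := (hu ▸ subset_union_left : X ⊆ M.E \ F).trans sdiff_subset
    have hXFE : X ∪ F ⊆ M.E := union_subset hXE hFE
    have hnc : ¬ IsConnected (M.restrict (X ∪ F)) := by
      intro hc
      have := hFmax _ ⟨hXFE, hlt, hc⟩
      rw [ncard_union_eq hXF (M.set_finite X hXE) (M.set_finite F hFE)] at this
      have := (ncard_pos (M.set_finite X hXE)).2 hX
      omega
    rw [hres _ hXFE] at hnc
    push Not at hnc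
    obtain ⟨C, D, hCD, hC, hD, hCDu, hCDle⟩ := hnc
    -- one of the two parts avoids `F`, hence separates `M`
    have hsep : ∀ C D : Set α, Disjoint C D → C.Nonempty → C ∪ D = X ∪ F → ρ C + ρ D ≤ ρ (X ∪ F) →
        ¬ Disjoint C F := by
      intro C D hCD hC hCDu hCDle hCF
      have hFD : F ⊆ D := fun x hx => ((hCDu.symm ▸ Or.inr hx : x ∈ C ∪ D)).resolve_left
        fun h => disjoint_left.1 hCF h hx
      have hCE : C ⊆ M.E := (hCDu ▸ subset_union_left : C ⊆ X ∪ F).trans hXFE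
      have h1 := hMc C (M.E \ C) disjoint_sdiff_right hC
        (hFne.mono fun x hx => ⟨hFE hx, fun h => disjoint_left.1 hCF h hx⟩)
        (union_sdiff_cancel hCE)
      -- Submodularity gives `ρ (E \ C) ≤ ρ D + ρ (Y ∪ F) - ρ F`, so `ρ C + ρ (E \ C) ≤ ρ (X ∪ F) +
      -- ρ (Y ∪ F) - ρ F ≤ k`.
      have h2 := hsub D (Y ∪ F)
      have h3 : ρ F ≤ ρ (D ∩ (Y ∪ F)) := hmono _ _ (subset_inter hFD subset_union_right)
      have h4 : ρ (M.E \ C) ≤ ρ (D ∪ (Y ∪ F)) := by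
        refine hmono _ _ ?_
        rintro x ⟨hxE, hxC⟩
        by_cases hxF : x ∈ F
        · exact Or.inr (Or.inr hxF)
        rcases (hu.symm ▸ ⟨hxE, hxF⟩ : x ∈ X ∪ Y) with h | h
        · exact Or.inl ((hCDu.symm ▸ Or.inl h : x ∈ C ∪ D).resolve_left hxC)
        · exact Or.inr (Or.inl h)
      omega
    have hC' := hsep C D hCD hC hCDu hCDle
    have hD' := hsep D C hCD.symm hD (by rw [union_comm, hCDu]) (by omega)
    have hFu : C ∩ F ∪ D ∩ F = F := by
      rw [← union_inter_distrib_right, hCDu, inter_eq_self_of_subset_right subset_union_right]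
    have h1 := (hres F hFE).1 hFc (C ∩ F) (D ∩ F) (hCD.mono inter_subset_left inter_subset_left)
      (not_disjoint_iff_nonempty_inter.1 hC') (not_disjoint_iff_nonempty_inter.1 hD') hFu
    -- Adding the two submodular inequalities yields `ρ (C ∩ F) + ρ (D ∩ F) ≤ ρ F`, against the
    -- connectedness of `M|F`.
    have h2 := hsub C F
    have h3 := hsub (C ∪ F) D
    have h4 : ρ (D ∩ F) ≤ ρ ((C ∪ F) ∩ D) :=
      hmono _ _ fun x hx => ⟨Or.inr hx.2, hx.1⟩
    have h5 : ρ (X ∪ F) ≤ ρ (C ∪ F ∪ D) :=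
      hmono _ _ (hCDu ▸ union_subset (subset_union_left.trans subset_union_left) subset_union_right)
    omega
  have hcontr : ∀ X Y, Disjoint X Y → X.Nonempty → Y.Nonempty → X ∪ Y = M.E \ F →
      k + ρ F < ρ (X ∪ F) + ρ (Y ∪ F) := by
    intro X Y hd hX hY hu
    by_contra! hle
    -- The two bounds add up to `k + |S ∩ F| ≤ ρ (X ∪ F) + ρ (Y ∪ F) ≤ k + ρ F`, contradicting the
    -- choice of `F`.
    have h1 := hgrow X Y hd hX hY hu hle
    have h2 := hgrow Y X hd.symm hY hX (by rw [union_comm, hu]) (by omega)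
    have hXF : Disjoint X F := disjoint_sdiff_left.mono_left (hu ▸ subset_union_left)
    have hYF : Disjoint Y F := disjoint_sdiff_left.mono_left (hu ▸ subset_union_right)
    rw [hadd X F hXF] at h1
    rw [hadd Y F hYF] at h2
    have h3 := hadd X Y hd
    have h4 := hadd (M.E \ F) F disjoint_sdiff_left
    rw [sdiff_union_of_subset hFE, inter_eq_self_of_subset_left hSE, hSk] at h4
    rw [hu] at h3
    omega
  have hflat : M.IsFlat F := by
    rw [Matroid.isFlat_iff_closure_eq]
    refine subset_antisymm (fun e he => ?_) (M.subset_closure F hFE)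
    by_contra heF
    have heE : e ∈ M.E := M.closure_subset_ground F he
    have hρe : ρ ({e} ∪ F) = ρ F := by
      refine le_antisymm ?_ (hmono _ _ subset_union_right)
      have h := M.eRk_mono (union_subset (singleton_subset_iff.2 he) (M.subset_closure F hFE))
      rw [M.eRk_closure_eq, hρ, hρ] at h
      exact_mod_cast h
    -- An element of the closure outside `F` would be a loop of `M/F` and split off from the rest.
    -- If there is no rest, then `ρ F = k`, impossible since `ρ F < |S ∩ F| ≤ k`.
    by_cases hne : ((M.E \ F) \ {e}).Nonempty
    · have := hcontr {e} ((M.E \ F) \ {e}) disjoint_sdiff_right (singleton_nonempty e) hne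
        (union_sdiff_cancel (singleton_subset_iff.2 ⟨heE, heF⟩))
      have := hρk ((M.E \ F) \ {e} ∪ F)
      omega
    · rw [not_nonempty_iff_eq_empty, sdiff_eq_empty] at hne
      have : ρ M.E ≤ ρ ({e} ∪ F) := hmono _ _ fun x hx => by
        by_cases hxF : x ∈ F
        · exact Or.inr hxF
        · exact Or.inl (hne ⟨hx, hxF⟩)
      omega
  -- Connectedness of `M` gives `k < ρ F + ρ (E \ F)`, and the last term is at most `k`, so `F` has
  -- positive rank.
  have hFmc := hMc F (M.E \ F) disjoint_sdiff_right hFne hFE' (union_sdiff_cancel hFE)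
  refine ⟨F, ⟨⟨hflat, hFc, (hcon F hFE).2 hcontr⟩, ?_, ?_, ?_⟩, (mem_cusp_iff hk (hρ F)).2
    ⟨hSE, hSk, hFρ⟩⟩
  · rw [hρ]
    have := hρk (M.E \ F)
    have : 0 < ρ F := by omega
    exact_mod_cast this
  · have hFf := M.set_finite F hFE
    rw [hρ, ← hFf.cast_ncard_eq]
    have := ncard_le_ncard (inter_subset_right (s := S) (t := F)) hFf
    exact_mod_cast hFρ.trans_le this
  · obtain ⟨e, he⟩ := hFE'
    refine ⟨e, he, fun hcol => ?_⟩
    -- A coloop would split off from `M` as a direct summand, so no element outside `F` is one.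
    have h1 := hMc {e} (M.E \ {e}) disjoint_sdiff_right (singleton_nonempty e)
      (hFne.mono fun x hx => ⟨hFE hx, fun h => he.2 (h ▸ hx)⟩)
      (union_sdiff_cancel (singleton_subset_iff.2 he.1))
    have h2 : ρ {e} ≤ 1 := by
      have := M.eRk_singleton_le e
      rw [hρ] at this
      exact_mod_cast this
    have h3 : ρ (M.E \ {e}) < k := by
      refine lt_of_le_of_ne (hρk _) fun h => ?_
      obtain ⟨I, hI⟩ := M.exists_isBasis (M.E \ {e}) sdiff_subset
      have hIb : M.IsBase I := hI.indep.isBase_of_eRk_ge (M.set_finite I hI.indep.subset_ground)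
        (by rw [hI.eRk_eq_eRk, hρ, h, hk])
      exact (hI.subset (hcol.mem_of_isBase hIb)).2 rfl
    omega

/-- In an elementary split matroid every dependent set of the size of a basis lies in the cusp of a
stressed subset. -/
theorem IsElementarySplit.exists_isStressed_mem_cusp [M.Finite] (hM : IsElementarySplit M)
    (hSE : S ⊆ M.E) (hS : S.encard = M.eRank) (hSb : ¬ M.IsBase S) :
    ∃ A, IsStressed M A ∧ S ∈ cusp M A := by
  rcases hM with ⟨hc, hs⟩ | ⟨M₁, M₂, hd, ⟨a, h₁⟩, ⟨b, h₂⟩, rfl⟩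
  · obtain ⟨F, hF, hSF⟩ := exists_isSplitFlacet_mem_cusp hc hSE hS hSb
    exact ⟨F, hs F hF, hSF⟩
  have hr₁ : M₁.eRank = a := by
    obtain ⟨B, hB⟩ := M₁.exists_isBase
    rw [← hB.encard_eq_eRank, ((h₁ B).1 hB).2]
  have hr₂ : M₂.eRank = b := by
    obtain ⟨B, hB⟩ := M₂.exists_isBase
    rw [← hB.encard_eq_eRank, ((h₂ B).1 hB).2]
  have hSE' : S ⊆ M₁.E ∪ M₂.E := by rwa [Matroid.disjointSum_ground_eq] at hSE
  have hsum : (S ∩ M₁.E).encard + (S ∩ M₂.E).encard = a + b := by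
    rw [← encard_union_eq (hd.mono inter_subset_right inter_subset_right),
      ← inter_union_distrib_left, inter_eq_self_of_subset_left hSE', hS, eRank_disjointSum, hr₁, hr₂]
  have hne : ¬ ((S ∩ M₁.E).encard = a ∧ (S ∩ M₂.E).encard = b) := by
    rintro ⟨e₁, e₂⟩
    exact hSb (Matroid.disjointSum_isBase_iff.2 ⟨(h₁ _).2 ⟨inter_subset_right, e₁⟩,
      (h₂ _).2 ⟨inter_subset_right, e₂⟩, hSE'⟩)
  have hSf := (M₁.disjointSum M₂ hd).set_finite S hSE
  -- The two intersections have total size `a + b` without having sizes `a` and `b`, so one of them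
  -- is too large.
  have hor : (a : ℕ∞) + 1 ≤ (S ∩ M₁.E).encard ∨ (b : ℕ∞) + 1 ≤ (S ∩ M₂.E).encard := by
    rw [← (hSf.subset inter_subset_left).cast_ncard_eq,
      ← (hSf.subset (inter_subset_left (t := M₂.E))).cast_ncard_eq] at hsum hne ⊢
    norm_cast at hsum hne ⊢
    omega
  rcases hor with h | h
  · refine ⟨M₁.E, ?_, hSE, hS, ?_⟩
    · rw [Matroid.disjointSum_comm]
      exact isStressed_disjointSum hd.symm ⟨b, h₂⟩ ⟨a, h₁⟩
    · rwa [eRk_disjointSum_left, hr₁]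
  · refine ⟨M₂.E, isStressed_disjointSum hd ⟨a, h₁⟩ ⟨b, h₂⟩, hSE, hS, ?_⟩
    rwa [eRk_disjointSum_right, hr₂]

end connectivity

end SplitMatroid

/-! ### Comparison with the uniform matroid -/

theorem theorem4p21 {A : Type*} [AddCommGroup A] (f : SplitMatroid.FinMatroid → A)
    (hinv : SplitMatroid.IsInvariant f) (hval : SplitMatroid.IsValuation f)
    (M : SplitMatroid.FinMatroid) (hM : SplitMatroid.IsElementarySplit M.1)
    (k n : ℕ) (hk : M.1.eRank = k) (hn : M.1.E.encard = n) :
    f M = f (SplitMatroid.uniform k n) -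
      ∑ r ∈ Finset.range (k + 1), ∑ h ∈ Finset.range (n + 1),
        SplitMatroid.stressedCount M.1 r h •
          (f (SplitMatroid.cuspidal r k h n) - f (SplitMatroid.uniformSum r k h n)) := by
  classical
  open Set SplitMatroid in
  have hfin : M.1.Finite := ⟨M.2⟩
  have hn' : M.1.E.ncard = n := (encard_eq_iff_ncard_of_subset subset_rfl n).1 hn
  have hTfin : {D | IsStressed M.1 D ∧ (cusp M.1 D).Nonempty}.Finite :=
    M.2.finite_subsets.subset fun D hD => hD.1.1
  obtain ⟨M', hE, hB, hf⟩ := hval.exists_relaxation_eq hinv M hk hn' hTfin.toFinset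
    fun D hD => (hTfin.mem_toFinset.1 hD).1
  -- Every `k`-set that is not a basis of `M` lies in some cusp, so relaxing all stressed subsets
  -- with non-empty cusp makes every `k`-set a basis.
  have hB' : ∀ B ⊆ M'.1.E, M'.1.IsBase B ↔ B.ncard = k := by
    intro B hBE
    rw [hE] at hBE
    rw [hB, ← encard_eq_iff_ncard_of_subset hBE, ← hk]
    constructor
    · rintro (h | ⟨D, -, h⟩)
      · exact h.encard_eq_eRank
      · exact h.2.1
    · intro h
      by_contra! hc
      obtain ⟨D, hD, hBD⟩ := hM.exists_isStressed_mem_cusp hBE h hc.1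
      exact hc.2 D (hTfin.mem_toFinset.2 ⟨hD, B, hBD⟩) hBD
  have hkn : k ≤ n := by
    obtain ⟨B, hb⟩ := M.1.exists_isBase
    rw [← IsBase.ncard_eq hk hb, ← hn']
    exact ncard_le_ncard hb.subset_ground M.2
  have hUE : (uniform k n).1.E = interval 0 n := rfl
  have hunif : f M' = f (uniform k n) := by
    refine hinv _ _ (Iso.of_forall_isBase_iff M'.2 (uniform k n).2 (A := ∅) (A' := ∅)
      (empty_subset _) (empty_subset _) (by rw [hE, hn', hUE, ncard_interval, Nat.sub_zero])
      (by simp) (fun s _ => s = k) hB' fun B hb => ?_)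
    have := uniformOn_isBase_iff (B := B) (interval_finite 0 n)
      (a := k) (by rw [ncard_interval]; omega)
    rw [and_iff_right (by exact hb)] at this
    exact this
  rw [← hunif, hf, eq_sub_iff_add_eq, add_right_inj]
  -- The correction term of `D` depends only on its rank and size, so the sum is regrouped along
  -- these; `stressedCount` is the size of a fibre.
  have hmaps : ∀ D ∈ hTfin.toFinset, ((M.1.eRk D).toNat, D.ncard) ∈
      Finset.range (k + 1) ×ˢ Finset.range (n + 1) := by
    intro D hD
    have hD := (hTfin.mem_toFinset.1 hD).1
    obtain ⟨r, hr⟩ := exists_eRk_eq M.1 D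
    have h1 := M.1.eRk_le_eRank D
    rw [hr, hk] at h1
    have h1 : r ≤ k := by exact_mod_cast h1
    have h2 : D.ncard ≤ n := hn' ▸ ncard_le_ncard hD.1 M.2
    rw [hr, ENat.toNat_natCast, Finset.mem_product, Finset.mem_range, Finset.mem_range]
    exact ⟨by omega, by omega⟩
  rw [← Finset.sum_fiberwise_of_maps_to hmaps, ← Finset.sum_product']
  refine Finset.sum_congr rfl fun p _ => ?_
  rw [Finset.sum_congr rfl (g := fun _ => f (cuspidal p.1 k p.2 n) - f (uniformSum p.1 k p.2 n))
    fun D hD => by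
      rw [Finset.mem_filter] at hD
      rw [← hD.2], Finset.sum_const, stressedCount, ← ncard_coe_finset]
  congr 2
  ext D
  simp only [mem_ofPred_eq, Finset.coe_filter, Set.Finite.mem_toFinset, and_assoc]
  refine and_congr_right fun hs => and_congr_right fun _ => ?_
  obtain ⟨r, hr⟩ := exists_eRk_eq M.1 D
  rw [encard_eq_iff_ncard_of_subset hs.1, hr, ENat.toNat_natCast, Prod.ext_iff]
  norm_cast
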